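/- Let $p$ be a prime, $\mathbf{F}_q$ a finite field of characteristic $p$, $\mathbf{Z}_q=W(\mathbf{F}_q)$ its ring of Witt vectors and $\mathbf{Q}_q$ the fraction field of $\mathbf{Z}_q$. Let $Q\in\mathbf{F}_q[x,y]$ be irreducible, monic in $y$ of degree $d_x$, and separable over $\mathbf{F}_q(x)$, and let $\mathcal{Q}\in\mathbf{Z}_q[x,y]$ be a lift of $Q$ that is monic in $y$ and has the same monomials in its support as $Q$. Let $\Delta\in\mathbf{Z}_q[x]$ be the discriminant of $\mathcal{Q}$ with respect to $y$ and $r=\Delta/\gcd(\Delta,\frac{d\Delta}{dx})$. Let $K=\mathbf{Q}_q(x,y)$ be the function field defined by $\mathcal{Q}(x,y)=0$, and $\mathbb{X}$ the smooth projective curve over $\mathbf{Q}_q$ with function field $K$. For a closed point $P$ of $\mathbb{X}$ over $x=\infty$ let $e_P$ be the ramification index of $x$ at $P$, $\kappa(P)$ the residue field, and $\deg P=[\kappa(P):\mathbf{Q}_q]$; the residue $\mathrm{res}_P(\omega)\in\kappa(P)$ of a $1$-form $\omega$ is the coefficient $a_{-1}$ in an expansion $\omega=(\cdots+a_{-1}z^{-1}+\cdots)\,dz$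 with coefficients in $\kappa(P)$, where $z$ is a local coordinate at $P$. Let $W^\infty\in GL_{d_x}(\mathbf{Z}_q[x,x^{-1}])$ be such that the functions $b_j^\infty=\sum_{i=0}^{d_x-1}W^\infty_{i+1,j+1}y^i$, $0\le j\le d_x-1$, form an integral basis of $K$ over $\mathbf{Q}_q[x^{-1}]$, i.e. a $\mathbf{Q}_q[x^{-1}]$-basis of the integral closure of $\mathbf{Q}_q[x^{-1}]$ in $K$. Let $G^\infty$ be the matrix over $\mathbf{Q}_q(x)$ with $db_j^\infty=\sum_{i=0}^{d_x-1} G^\infty_{i+1,j+1}b_i^\infty\,dx$ for all $j$, and let $G^\infty_{-1}\in M_{d_x\times d_x}(\mathbf{Q}_q)$ be the residue matrix of $G^\infty dx$ at $x=\infty$: with $t=1/x$, it is the coefficient of $t^{-1}dt$ in the expansion of $G^\infty dx$ at $t=0$. Let $$\omega=\Big(\sum_{i=0}^{d_x-1}u_i\,b_i^\infty\Big)\frac{dx}{r},\qquad u\in\mathbf{Q}_q[x,x^{-1}]^{\oplus d_x},\quad \mathrm{ord}_\infty(u)>-\deg(r),$$ where $\mathrm{ord}_\infty(u)$ is the minimum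 of the orders of the entries of $u$ at $x=\infty$, and let $v=\big(x^{1-\deg(r)}u\big)|_{x=\infty}\in\mathbf{Q}_q^{\oplus d_x}$. Then: 1. $G^\infty_{-1}$ is diagonalisable over $\mathbf{Q}_q$. 2. Its eigenvalues are the numbers $j/e_P$, where $P$ runs over the closed points of $\mathbb{X}$ over $x=\infty$ and $0\le j\le e_P-1$, each pair $(P,j)$ contributing with multiplicity $\deg P$; that is, the characteristic polynomial of $G^\infty_{-1}$ is $\prod_{P}\prod_{j=0}^{e_P-1}(X-j/e_P)^{\deg P}$. 3. At every closed point $P$ over $x=\infty$ the residue $\mathrm{res}_P(\omega)$ exists and is independent of the expansion. 4. $\mathbf{Q}_q^{\oplus d_x}$ is the direct sum of the generalised eigenspaces $V_\lambda$, $\lambda\in\mathbf{Q}_q$, of $G^\infty_{-1}$, and $\mathrm{res}_P(\omega)=0$ for all $P$ over $x=\infty$ if and only if the projection of $v$ onto $V_0$ is $0$. -/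

import Mathlib

open Polynomial KaehlerDifferential
open scoped LaurentPolynomial

noncomputable section

/-! ### Rational functions in `x` near `x = ∞` -/

/-- The map `k[x] → k((t))`, `x ↦ t⁻¹`, sends nonzero polynomials to nonzero series. -/
theorem aeval_single_neg_one_injective (k : Type*) [Field k] :
    Function.Injective
      (Polynomial.aeval (R := k) (HahnSeries.single (-1 : ℤ) (1 : k) : LaurentSeries k)) := by
  rw [injective_iff_map_eq_zero]
  intro f hf
  ext n
  have h := congrArg (fun s : LaurentSeries k => s.coeff (-(n : ℤ))) hf
  simp only [Polynomial.aeval_eq_sum_range, HahnSeries.coeff_sum, HahnSeries.single_pow,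
    Algebra.smul_def, HahnSeries.algebraMap_apply', PowerSeries.algebraMap_apply,
    HahnSeries.ofPowerSeries_C, HahnSeries.C_apply, HahnSeries.single_mul_single,
    HahnSeries.coeff_zero, HahnSeries.coeff_single, one_pow, Algebra.algebraMap_self,
    RingHom.id_apply, mul_one, zero_add, mul_neg] at h
  by_cases hn : n ∈ Finset.range (f.natDegree + 1)
  · rw [Finset.sum_eq_single n] at h
    · simpa using h
    · intro m _ hm
      rw [if_neg]
      simpa using fun h' => hm h'.symm
    · exact fun h' => absurd hn h'
  · rw [Finset.mem_range, not_lt] at hn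
    simpa using Polynomial.coeff_eq_zero_of_natDegree_lt hn

/-- The expansion of a rational function of `x` at `x = ∞` as a Laurent series in `t = 1/x`. -/
def expandInfty (k : Type*) [Field k] : RatFunc k →ₐ[k] LaurentSeries k :=
  RatFunc.liftAlgHom (Polynomial.aeval (HahnSeries.single (-1 : ℤ) (1 : k)))
    (nonZeroDivisors_le_comap_nonZeroDivisors_of_injective _ (aeval_single_neg_one_injective k))

/-- The order `ord_∞` of a rational function at `x = ∞` (it is `⊤` at the zero function). -/
def ordInfty {k : Type*} [Field k] (f : RatFunc k) : WithTop ℤ :=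
  (expandInfty k f).orderTop

/-- The order at `x = ∞` of a vector: the minimum over its entries. -/
def ordInftyVec {k : Type*} [Field k] {d : ℕ} (u : Fin d → RatFunc k) : WithTop ℤ :=
  Finset.univ.inf fun i => ordInfty (u i)

/-- The value at `x = ∞` of a rational function that is regular there. -/
def valueAtInfty {k : Type*} [Field k] (f : RatFunc k) : k :=
  (expandInfty k f).coeff 0

/-- The residue matrix at `x = ∞` of the matrix of `1`-forms `G dx`. As `dx = -t⁻² dt` for
`t = 1/x`, it is the coefficient of `t⁻¹` in the expansion of `-t⁻² G`. -/
def residueMatrixInfty {k : Type*} [Field k] {d : ℕ} (G : Matrix (Fin d) (Fin d) (RatFunc k)) :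
    Matrix (Fin d) (Fin d) k :=
  Matrix.of fun i j =>
    (-(HahnSeries.single (-2 : ℤ) (1 : k)) * expandInfty k (G i j)).coeff (-1)

/-- The residue matrix as an endomorphism of the space `k^d` of column vectors. -/
def residueEndInfty {k : Type*} [Field k] {d : ℕ} (G : Matrix (Fin d) (Fin d) (RatFunc k)) :
    Module.End k (Fin d → k) :=
  Matrix.toLin' (residueMatrixInfty G)

/-- A Laurent polynomial in `x` with coefficients in `R`, as a rational function over `k`. -/
def laurentToRatFunc (R k : Type*) [CommRing R] [Field k] [Algebra R k] :
    R[T;T⁻¹] →+* RatFunc k :=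
  LaurentPolynomial.eval₂ ((algebraMap k (RatFunc k)).comp (algebraMap R k))
    (Units.mk0 (RatFunc.X : RatFunc k) RatFunc.X_ne_zero)

/-! ### Points over `x = ∞` and residues in a function field `K` over `k` -/

section Points

variable (k : Type*) {K : Type*} [Field k] [Field K] [Algebra k K] (x : K)

/-- The ring `k[1/x]`. -/
abbrev CoordInfty : Subalgebra k K := Algebra.adjoin k {x⁻¹}

/-- The integral closure of `k[1/x]` in `K`: the functions regular away from `x = 0`. -/
abbrev IntegralInfty : Subalgebra (CoordInfty k x) K := integralClosure (CoordInfty k x) K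

/-- The function `1/x` as an element of `k[1/x]`. -/
def invCoord : CoordInfty k x := ⟨x⁻¹, Algebra.subset_adjoin rfl⟩

/-- A family `b` is an integral basis of `K` over `k[1/x]`: a basis of the integral closure of
`k[1/x]` in `K` as a module over `k[1/x]`. -/
def IsIntegralBasisInfty {d : ℕ} (b : Fin d → K) : Prop :=
  LinearIndependent (CoordInfty k x) b ∧
    Submodule.span (CoordInfty k x) (Set.range b) = Subalgebra.toSubmodule (IntegralInfty k x)

/-- A (closed) point over `x = ∞` of the smooth projective curve over `k` with function field `K`:
a maximal ideal, containing `1/x`, of the integral closure of `k[1/x]`. -/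
structure PointInfty where
  ideal : Ideal (IntegralInfty k x)
  isMaximal : ideal.IsMaximal
  inv_mem : algebraMap (CoordInfty k x) (IntegralInfty k x) (invCoord k x) ∈ ideal

variable {k x}

/-- The residue field of a point over `x = ∞`. -/
abbrev PointInfty.ResidueField (P : PointInfty k x) : Type _ := IntegralInfty k x ⧸ P.ideal

/-- The ramification index `e_P` of the map `x` at a point over `x = ∞`. -/
def PointInfty.ramificationIndex (P : PointInfty k x) : ℕ :=
  P.ideal.ramificationIdx (CoordInfty k x)

/-- The degree over `k` of the residue field of a point over `x = ∞`. -/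
def PointInfty.residueDegree (P : PointInfty k x) : ℕ :=
  Module.finrank k P.ResidueField

/-- `φ` is a Laurent series expansion at `P` in the local coordinate `z`, with coefficients in the
residue field of `P`: a homomorphism of `k`-algebras that sends `z` to the variable of the Laurent
series, and functions regular at `P` to power series whose constant term is the value at `P`. -/
structure PointInfty.IsLaurentExpansion (P : PointInfty k x) (z : K)
    (φ : K →ₐ[k] LaurentSeries P.ResidueField) : Prop where
  map_coord : φ z = HahnSeries.single 1 1
  map_regular : ∀ f : IntegralInfty k x, ∃ s : PowerSeries P.ResidueField,
    φ (f : K) = (s : LaurentSeries P.ResidueField) ∧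
      PowerSeries.constantCoeff s = Ideal.Quotient.mk P.ideal f

/-- `a` is the residue at `P` of the `1`-form `ω`: the coefficient `a₋₁` in an expansion
`ω = (⋯ + a₋₁ z⁻¹ + ⋯) dz`. -/
def PointInfty.HasResidue (P : PointInfty k x) (ω : Ω[K⁄k]) (a : P.ResidueField) : Prop :=
  ∃ (z f : K) (φ : K →ₐ[k] LaurentSeries P.ResidueField),
    P.IsLaurentExpansion z φ ∧ ω = f • D k K z ∧ (φ f).coeff (-1) = a

end Points

/-! ### Decomposition into generalised eigenspaces -/

open Classical in
/-- `T` is diagonalisable over `k`: the space is the direct sum of the eigenspaces of `T`. -/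
def IsDiagonalisable {k V : Type*} [Field k] [AddCommGroup V] [Module k V]
    (T : Module.End k V) : Prop :=
  DirectSum.IsInternal fun μ : k => T.eigenspace μ

open Classical in
/-- The space is the direct sum of the generalised eigenspaces of `T` with eigenvalues in `k`. -/
def HasGenEigenDecomposition {k V : Type*} [Field k] [AddCommGroup V] [Module k V]
    (T : Module.End k V) : Prop :=
  DirectSum.IsInternal fun μ : k => T.maxGenEigenspace μ

open Classical in
/-- If `V` is the direct sum of the generalised eigenspaces of `T`, the projection of `V` onto the
generalised eigenspace with eigenvalue `μ`. -/
def genEigenProj {k V : Type*} [Field k] [AddCommGroup V] [Module k V] (T : Module.End k V)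
    (h : HasGenEigenDecomposition T) (μ : k) (v : V) : T.maxGenEigenspace μ :=
  (Equiv.ofBijective _ h).symm v μ

/-! ### The curve and its lift -/

/-- The field `ℚ_q`, for `F` the field with `q` elements (of characteristic `p`): the fraction
field of the ring `ℤ_q = W(F)`. -/
abbrev QqField (p : ℕ) [Fact p.Prime] (F : Type*) [Field F] [CharP F p] : Type _ :=
  FractionRing (WittVector p F)

/-- A plane equation `Q(x, y) = 0` over the finite field `F`, irreducible, monic and separable in
`y`, with a lift to `ℤ_q[x, y]` that is monic in `y` and has the same monomials in its support.
Elements of `R[X][X]` are polynomials in `y` over `R[x]`. -/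
structure PlaneCurveLift (p : ℕ) [Fact p.Prime] (F : Type*) [Field F] [CharP F p] where
  Q : F[X][X]
  irreducible : Irreducible Q
  monic : Q.Monic
  separable : (Q.map (algebraMap F[X] (RatFunc F))).Separable
  lift : (WittVector p F)[X][X]
  lift_monic : lift.Monic
  lift_reduces : lift.map (Polynomial.mapRingHom WittVector.constantCoeff) = Q
  lift_support : ∀ i, (lift.coeff i).support = (Q.coeff i).support

namespace PlaneCurveLift

variable {p : ℕ} [Fact p.Prime] {F : Type*} [Field F] [CharP F p]

/-- The map `ℤ_q[x] → ℚ_q(x)`. -/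
def toRatFunc (p : ℕ) [Fact p.Prime] (F : Type*) [Field F] [CharP F p] :
    (WittVector p F)[X] →+* RatFunc (QqField p F) :=
  (algebraMap (QqField p F)[X] (RatFunc (QqField p F))).comp
    (Polynomial.mapRingHom (algebraMap (WittVector p F) (QqField p F)))

/-- `ℚ_q(x)` is the fraction field of `ℤ_q[x]`. -/
theorem isFractionRing_toRatFunc :
    letI := (toRatFunc p F).toAlgebra
    IsFractionRing (WittVector p F)[X] (RatFunc (QqField p F)) := by
  letI := (toRatFunc p F).toAlgebra
  have hinj : Function.Injective (toRatFunc p F) :=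
    (IsFractionRing.injective (QqField p F)[X] (RatFunc (QqField p F))).comp
      (Polynomial.map_injective _ (IsFractionRing.injective (WittVector p F) (QqField p F)))
  haveI : FaithfulSMul (WittVector p F)[X] (RatFunc (QqField p F)) :=
    (faithfulSMul_iff_algebraMap_injective _ _).2 hinj
  have key : ∀ f : (QqField p F)[X], ∃ (b : WittVector p F) (g : (WittVector p F)[X]), b ≠ 0 ∧
      algebraMap (QqField p F)[X] (RatFunc (QqField p F)) f
        = toRatFunc p F g / toRatFunc p F (C b) := by
    intro f
    obtain ⟨b, hbm, hb⟩ := IsLocalization.integerNormalization_spec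
      (nonZeroDivisors (WittVector p F)) f
    have hb0 : b ≠ 0 := nonZeroDivisors.ne_zero hbm
    refine ⟨b, IsLocalization.integerNormalization (nonZeroDivisors (WittVector p F)) f, hb0, ?_⟩
    have hne : toRatFunc p F (C b) ≠ 0 := by
      rw [Ne, map_eq_zero_iff _ hinj, Polynomial.C_eq_zero]
      exact hb0
    rw [eq_div_iff hne]
    simp only [toRatFunc, RingHom.comp_apply, Polynomial.coe_mapRingHom, hb, ← map_mul,
      Polynomial.map_C]
    congr 1
    rw [mul_comm, ← Polynomial.smul_eq_C_mul, algebraMap_smul]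
  refine IsFractionRing.of_field _ _ fun z => ?_
  obtain ⟨f, g, hg, rfl⟩ := IsFractionRing.div_surjective (A := (QqField p F)[X]) z
  obtain ⟨b, f', hb, hf⟩ := key f
  obtain ⟨c, g', hc, hg'⟩ := key g
  refine ⟨f' * C c, g' * C b, ?_⟩
  rw [hf, hg']
  change _ = toRatFunc p F _ / toRatFunc p F _
  rw [map_mul, map_mul, div_div_div_eq, mul_comm (toRatFunc p F (C b))]

variable (E : PlaneCurveLift p F)

/-- The degree `d_x` of the map `x`. -/
abbrev degX : ℕ := E.Q.natDegree

/-- The lift of the equation, as a polynomial in `y` over `ℚ_q(x)`. -/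
def genericPoly : (RatFunc (QqField p F))[X] := E.lift.map (toRatFunc p F)

instance irreducible_genericPoly [Finite F] : Fact (Irreducible E.genericPoly) := by
  letI := (toRatFunc p F).toAlgebra
  haveI := isFractionRing_toRatFunc (p := p) (F := F)
  haveI : ExpChar F p := ExpChar.prime Fact.out
  have h1 : Irreducible E.lift :=
    E.lift_monic.irreducible_of_irreducible_map
      (Polynomial.mapRingHom (WittVector.constantCoeff (p := p) (R := F))) _
      (by rw [E.lift_reduces]; exact E.irreducible)
  exact ⟨(E.lift_monic.irreducible_iff_irreducible_map_fraction_map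
    (K := RatFunc (QqField p F))).1 h1⟩

/-- The function field `ℚ_q(x, y)` of the lifted curve. -/
def FunctionField : Type _ := AdjoinRoot E.genericPoly

instance [Finite F] : Field E.FunctionField :=
  inferInstanceAs (Field (AdjoinRoot E.genericPoly))

instance [Finite F] : Algebra (RatFunc (QqField p F)) E.FunctionField :=
  inferInstanceAs (Algebra (RatFunc (QqField p F)) (AdjoinRoot E.genericPoly))

instance [Finite F] : Algebra (QqField p F) E.FunctionField :=
  inferInstanceAs (Algebra (QqField p F) (AdjoinRoot E.genericPoly))

instance [Finite F] : IsScalarTower (QqField p F) (RatFunc (QqField p F)) E.FunctionField :=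
  inferInstanceAs (IsScalarTower (QqField p F) (RatFunc (QqField p F)) (AdjoinRoot E.genericPoly))

/-- The function `x`. -/
def x [Finite F] : E.FunctionField := algebraMap (RatFunc (QqField p F)) E.FunctionField RatFunc.X

/-- The function `y`. -/
def y [Finite F] : E.FunctionField := AdjoinRoot.root E.genericPoly

/-- `r = Δ / gcd(Δ, dΔ/dx)` in `ℤ_q[x]`, where `Δ` is the discriminant of the lift with respect to
`y`. As the gcd, `r` is only determined up to units of `ℤ_q`. -/
def IsSquarefreeDiscr (r : (WittVector p F)[X]) : Prop :=
  ∃ g : (WittVector p F)[X],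
    (g ∣ E.lift.discr ∧ g ∣ derivative E.lift.discr ∧
      ∀ h, h ∣ E.lift.discr → h ∣ derivative E.lift.discr → h ∣ g) ∧
    E.lift.discr = r * g

/-- The functions `b_j = ∑_i W_{ij} y^i`. -/
def basisInfty [Finite F]
    (W : Matrix.GeneralLinearGroup (Fin E.degX) (WittVector p F)[T;T⁻¹]) (j : Fin E.degX) :
    E.FunctionField :=
  ∑ i : Fin E.degX,
    laurentToRatFunc (WittVector p F) (QqField p F)
      ((W : Matrix (Fin E.degX) (Fin E.degX) (WittVector p F)[T;T⁻¹]) i j) • E.y ^ (i : ℕ)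

/-- `G dx` is the matrix of the connection `d` with respect to `b`:
`d b_j = ∑_i G_{ij} b_i dx` for all `j`. -/
def IsConnectionMatrix [Finite F] (b : Fin E.degX → E.FunctionField)
    (G : Matrix (Fin E.degX) (Fin E.degX) (RatFunc (QqField p F))) : Prop :=
  ∀ j, D (QqField p F) E.FunctionField (b j) =
    (∑ i, G i j • b i) • D (QqField p F) E.FunctionField E.x

/-- The `1`-form `(∑_i u_i b_i) dx / r`. -/
def formInfty [Finite F] (b : Fin E.degX → E.FunctionField) (r : (WittVector p F)[X])
    (u : Fin E.degX → RatFunc (QqField p F)) : Ω[E.FunctionField⁄QqField p F] :=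
  ((∑ i, u i • b i) / algebraMap (RatFunc (QqField p F)) E.FunctionField (toRatFunc p F r)) •
    D (QqField p F) E.FunctionField E.x

end PlaneCurveLift

end

/-!
Write `k = ℚ_q`, `t = 1/x`, and let `Θ = t d/dt = -x d/dx`, extended to `K`. The residue matrix `N`
is the value at infinity of the matrix of `Θ` with respect to the integral basis `b`: for `c ∈ k^d`,
the functions `∑ (N c)_i b_i` and `Θ (∑ c_i b_i)` differ by a multiple of `t` in the local ring at
every point `P` over `x = ∞`.

If `z` is a uniformizer at `P`, then `dt / t = (e_P + ⋯) dz / z`, so that `Θ` multiplies functions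
vanishing to order `j` at `P` by `j / e_P`, up to functions vanishing to order `j + 1`
(`ResidueMap.val_logDerivation_sub_le`). Filtering `k^d` by the order of vanishing at `P` of
`∑ c_i b_i`, for `0 ≤ j ≤ e_P`, gives for each `P` a filtration on whose `j`-th step `N - j / e_P`
maps into the next one (`exists_exponentFiltration`). A combination of the `b_i` that vanishes to
order `e_P` at all `P` is divisible by `t`, hence zero, so that the filtrations are jointly
separating. This alone implies the statements on `N`. The product of the distinct factors
`N - j / e_P` is zero, so `N` is diagonalisable. Leading coefficients embed the eigenspace of `μ`
into the sum of the residue fields `κ(P)` over the pairs `(P, j)` with `j / e_P = μ`; as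
`∑ e_P deg P = d`, all these embeddings are bijective, which gives the characteristic polynomial
(`ExponentFiltration.charpoly_eq`). Finally, the projection of `v` to the `0`-eigenspace is zero
exactly if `∑ v_i b_i` vanishes at every `P`: the image of `N` consists of vectors with this
property, and an eigenvector for `0` that has it climbs up all filtrations, because `j / e_P ≠ 0`
for `j > 0` (`ExponentFiltration.genEigenProj_zero_eq_zero_iff`).

As for residues, every function `g` can be written as `a + Θ h` with `a` regular at `P`, because `Θ`
is invertible on polar parts. Then `g dt / t = a dt / t + dh`, and in every expansion its
coefficient at `z⁻¹ dz` is `e_P a(P)`: the coefficient of an exact form is zero, and `dt / t` has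
coefficient `e_P` (`ResidueMap.IsExpansion.coeff_eq`). So the residue is unique once there is an
expansion at all, and Taylor series with respect to `d/dz` provide one
(`ResidueMap.exists_isExpansion`). That `d/dz` preserves the local ring at `P` is shown by comparing
the pole orders of `df` for all regular `f`, see `ResidueMap.val_derivation_le`. For the form in
question, `g` is a regular function that agrees at `P`, up to a unit, with `∑ v_i b_i`, so that its
residue vanishes exactly if `∑ v_i b_i` does.
-/

noncomputable section

/-! ### Endomorphisms with a filtration of prescribed exponents -/

section Exponents

open Module

variable {k V : Type*} [Field k] [AddCommGroup V] [Module k V]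

/-- A vector killed by a product of distinct factors `T - s` is a sum of eigenvectors. -/
theorem Module.End.mem_biSup_eigenspace_of_aeval_prod_eq_zero (T : Module.End k V) (S : Finset k) :
    ∀ v : V, aeval T (∏ s ∈ S, (X - C s)) v = 0 → v ∈ ⨆ μ ∈ S, T.eigenspace μ := by
  classical
  induction S using Finset.induction_on with
  | empty => intro v hv; simpa using hv
  | insert s S hs ih =>
    intro v hv
    rw [Finset.prod_insert hs, mul_comm, map_mul] at hv
    have hw := ih _ hv
    have hmap : (⨆ μ ∈ S, T.eigenspace μ) ≤
        (⨆ μ ∈ S, T.eigenspace μ).map (T - algebraMap k (Module.End k V) s) := by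
      refine iSup₂_le fun μ hμ w hw => ?_
      have hne : μ - s ≠ 0 := sub_ne_zero.2 fun h => hs (h ▸ hμ)
      refine ⟨(μ - s)⁻¹ • w, Submodule.smul_mem _ _ (le_iSup₂ (f := fun μ _ => T.eigenspace μ)
        μ hμ hw), ?_⟩
      rw [Module.End.mem_eigenspace_iff] at hw
      simp [hw, ← sub_smul, smul_smul, inv_mul_cancel₀ hne]
    obtain ⟨v', hv', he⟩ := hmap hw
    have hv'' : v - v' ∈ T.eigenspace s := by
      rw [Module.End.mem_eigenspace_iff]
      simp only [aeval_sub, aeval_X, aeval_C] at he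
      have : (T - algebraMap k (Module.End k V) s) (v - v') = 0 := by rw [map_sub, he, sub_self]
      simpa [sub_eq_zero] using this
    rw [← sub_add_cancel v v']
    refine Submodule.add_mem _ (le_iSup₂ (f := fun μ _ => T.eigenspace μ) s
      (Finset.mem_insert_self s S) hv'') ?_
    exact (biSup_mono (f := T.eigenspace) fun μ hμ => Finset.mem_insert_of_mem hμ :
      (⨆ μ ∈ S, T.eigenspace μ) ≤ _) hv'

theorem finrank_biSup_le [FiniteDimensional k V] {ι : Type*} (S : Finset ι)
    (E : ι → Submodule k V) :
    finrank k (⨆ i ∈ S, E i : Submodule k V) ≤ ∑ i ∈ S, finrank k (E i) := by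
  classical
  induction S using Finset.induction_on with
  | empty => simp
  | insert i S hi ih =>
    rw [Finset.iSup_insert, Finset.sum_insert hi]
    exact (Submodule.finrank_add_le_finrank_add_finrank _ _).trans (Nat.add_le_add_left ih _)

theorem Multiset.sum_count_le_card {α : Type*} [DecidableEq α] (m : Multiset α)
    (S : Finset α) : ∑ a ∈ S, m.count a ≤ m.card := by
  rw [← m.toFinset_sum_count_eq]
  refine Finset.sum_le_sum_of_ne_zero fun a _ ha => ?_
  rw [Multiset.mem_toFinset]
  exact Multiset.count_ne_zero.1 ha

/-- For each `P` a filtration `F P 0 = V, F P 1, …, F P (e P)` of `V`, such that `T - j / e P` maps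
its `j`-th step into the next one; the filtrations are jointly separating. The linear map `symb P j`
to the space `κ P` detects which elements of `F P j` are in `F P (j + 1)`. Its values outside of
`F P j` are irrelevant. The inclusions `F P (j + 1) ≤ F P j` hold in the application but are not
required. -/
structure ExponentFiltration (T : Module.End k V) {ι : Type*} (e : ι → ℕ) (κ : ι → Type*)
    [∀ P, AddCommGroup (κ P)] [∀ P, Module k (κ P)] where
  F : ι → ℕ → Submodule k V
  F_zero : ∀ P, F P 0 = ⊤
  sub_mem : ∀ P j, j < e P → ∀ c ∈ F P j, T c - ((j : k) / (e P : k)) • c ∈ F P (j + 1)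
  eq_zero : ∀ c, (∀ P, c ∈ F P (e P)) → c = 0
  symb : ∀ P, ℕ → V →ₗ[k] κ P
  mem_succ : ∀ P j, j < e P → ∀ c ∈ F P j, symb P j c = 0 → c ∈ F P (j + 1)

namespace ExponentFiltration

variable {T : Module.End k V} {ι : Type*} {e : ι → ℕ} {κ : ι → Type*}
  [∀ P, AddCommGroup (κ P)] [∀ P, Module k (κ P)] (H : ExponentFiltration T e κ)

/-- The finite set of the numbers `j / e P` with `j < e P`. -/
def exponents (k : Type*) [Field k] {ι : Type*} [Fintype ι] (e : ι → ℕ) : Finset k :=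
  open Classical in
  Finset.univ.biUnion fun P => (Finset.range (e P)).image fun j : ℕ => (j : k) / (e P : k)

include H

theorem aeval_prod_mem [CharZero k] (P : ι) (c : V) (n : ℕ) (hn : n ≤ e P) :
    aeval T (∏ j ∈ Finset.range n, (X - C ((j : k) / (e P : k)))) c ∈ H.F P n := by
  induction n with
  | zero => simp [H.F_zero]
  | succ n ih =>
    rw [Finset.prod_range_succ, mul_comm, map_mul]
    simpa using H.sub_mem P n (by omega) _ (ih (by omega))

/-- An eigenvector in `F P j` whose eigenvalue is not `j / e P` is in `F P (j + 1)`. -/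
theorem F_stable_succ {P : ι} {j : ℕ} (hj : j < e P) {c : V} (hc : c ∈ H.F P j) {μ : k}
    (hμ : T c = μ • c) (hne : μ ≠ (j : k) / (e P : k)) : c ∈ H.F P (j + 1) := by
  have h := H.sub_mem P j hj c hc
  rw [hμ, ← sub_smul] at h
  simpa [smul_smul, inv_mul_cancel₀ (sub_ne_zero.2 hne)] using
    Submodule.smul_mem _ (μ - (j : k) / (e P : k))⁻¹ h

/-- As `F P j` need not be `T`-stable, the product is reordered to start with the factors for
`P`. -/
theorem aeval_prod_exponents_eq_zero [CharZero k] [Fintype ι] :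
    aeval T (∏ s ∈ exponents k e, (X - C s)) = 0 := by
  classical
  ext c : 1
  refine H.eq_zero _ fun P => ?_
  have hsub : (Finset.range (e P)).image (fun j : ℕ => (j : k) / (e P : k)) ⊆ exponents k e := by
    intro s hs
    exact Finset.mem_biUnion.2 ⟨P, Finset.mem_univ P, hs⟩
  have hinj : Set.InjOn (fun j : ℕ => (j : k) / (e P : k)) (Finset.range (e P)) := by
    intro i hi j hj h
    have hi : i < e P := by simpa using hi
    have he : (e P : k) ≠ 0 := Nat.cast_ne_zero.2 (by omega)
    simpa [div_left_inj' he] using h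
  rw [← Finset.prod_sdiff hsub, Finset.prod_image hinj, mul_comm, map_mul]
  exact H.aeval_prod_mem P _ _ le_rfl

theorem isSemisimple [CharZero k] [Fintype ι] : T.IsSemisimple := by
  refine Module.End.isSemisimple_of_squarefree_aeval_eq_zero ?_ H.aeval_prod_exponents_eq_zero
  exact (separable_prod_X_sub_C_iff' (f := fun s : k => s)).2 (fun _ _ _ _ h => h) |>.squarefree

theorem biSup_eigenspace_eq_top [CharZero k] [Fintype ι] :
    ⨆ μ ∈ exponents k e, T.eigenspace μ = ⊤ := by
  rw [eq_top_iff]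
  intro v _
  refine T.mem_biSup_eigenspace_of_aeval_prod_eq_zero _ v ?_
  rw [H.aeval_prod_exponents_eq_zero]
  rfl

theorem maxGenEigenspace_eq [CharZero k] [Fintype ι] (μ : k) :
    T.maxGenEigenspace μ = T.eigenspace μ := by
  exact H.isSemisimple.isFinitelySemisimple.maxGenEigenspace_eq_eigenspace μ

theorem isDiagonalisable [CharZero k] [Fintype ι] : IsDiagonalisable T := by
  classical
  unfold IsDiagonalisable
  rw [DirectSum.isInternal_submodule_iff_iSupIndep_and_iSup_eq_top]
  refine ⟨T.eigenspaces_iSupIndep, ?_⟩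
  rw [eq_top_iff, ← H.biSup_eigenspace_eq_top]
  exact iSup_mono fun μ => iSup_le fun _ => le_rfl

theorem hasGenEigenDecomposition [CharZero k] [Fintype ι] : HasGenEigenDecomposition T := by
  have h := H.isDiagonalisable
  unfold IsDiagonalisable at h
  unfold HasGenEigenDecomposition
  convert! h using 2
  ext μ : 1
  rw [H.maxGenEigenspace_eq]

omit H in
/-- The multiplicity expected of `μ`: each pair `(P, j)` with `j / e P = μ` contributes the
dimension of `κ P`. -/
def mult (e : ι → ℕ) (κ : ι → Type*) [∀ P, AddCommGroup (κ P)] [∀ P, Module k (κ P)]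
    [Fintype ι] (μ : k) : ℕ :=
  open Classical in
  ∑ P, ∑ j ∈ Finset.range (e P), if (j : k) / (e P : k) = μ then finrank k (κ P) else 0

/-- The symbols at the pairs `(P, j)` with `j / e P = μ` are jointly injective on the eigenspace
of `μ`: an eigenvector on which they vanish climbs up each filtration, at the other steps because
`μ` is not the exponent there. -/
theorem finrank_eigenspace_le [CharZero k] [Fintype ι] [∀ P, FiniteDimensional k (κ P)] (μ : k) :
    finrank k (T.eigenspace μ) ≤ mult e κ μ := by
  classical
  let I := Finset.univ.sigma fun P : ι =>
    (Finset.range (e P)).filter fun j : ℕ => (j : k) / (e P : k) = μ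
  let g : T.eigenspace μ →ₗ[k] (∀ i : I, κ i.1.1) :=
    LinearMap.pi fun i => (H.symb i.1.1 i.1.2).comp (T.eigenspace μ).subtype
  have hg : Function.Injective g := by
    rw [injective_iff_map_eq_zero]
    rintro ⟨c, hc⟩ h0
    rw [Submodule.mk_eq_zero]
    have hTc : T c = μ • c := Module.End.mem_eigenspace_iff.1 hc
    have key : ∀ P j, j ≤ e P → c ∈ H.F P j := by
      intro P j
      induction j with
      | zero => intro _; simp [H.F_zero]
      | succ j ih =>
        intro hj
        by_cases hμ : (j : k) / (e P : k) = μ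
        · refine H.mem_succ P j (by omega) c (ih (by omega)) ?_
          exact congrFun h0 ⟨⟨P, j⟩, by
            simp only [I, Finset.mem_sigma, Finset.mem_univ, Finset.mem_filter, Finset.mem_range,
              true_and]
            exact ⟨by omega, hμ⟩⟩
        · exact H.F_stable_succ (by omega) (ih (by omega)) hTc fun h => hμ h.symm
    exact H.eq_zero c fun P => key P _ le_rfl
  refine (LinearMap.finrank_le_finrank_of_injective hg).trans (le_of_eq ?_)
  rw [Module.finrank_pi_fintype, Finset.sum_coe_sort I fun i => finrank k (κ i.1)]
  simp only [I, Finset.sum_sigma, Finset.sum_filter, mult]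

/-- The bounds on the dimensions of the eigenspaces add up to the dimension of `V`, so that they are
attained. -/
theorem charpoly_eq [CharZero k] [Fintype ι] [∀ P, FiniteDimensional k (κ P)]
    [FiniteDimensional k V] (hd : ∑ P, e P * finrank k (κ P) = finrank k V) :
    T.charpoly = ∏ P, ∏ j ∈ Finset.range (e P),
      (X - C ((j : k) / (e P : k))) ^ finrank k (κ P) := by
  classical
  set R : k[X] := ∏ P, ∏ j ∈ Finset.range (e P),
      (X - C ((j : k) / (e P : k))) ^ finrank k (κ P) with hR
  have hmonic : R.Monic :=
    monic_prod_of_monic _ _ fun P _ => monic_prod_of_monic _ _ fun j _ => (monic_X_sub_C _).pow _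
  have hcount : ∀ μ, R.roots.count μ = mult e κ μ := by
    intro μ
    rw [hR, roots_prod _ _ hmonic.ne_zero, Multiset.count_bind]
    simp only [mult, Finset.sum_map_val]
    refine Finset.sum_congr rfl fun P _ => ?_
    rw [roots_prod _ _ (monic_prod_of_monic _ _ fun j _ => (monic_X_sub_C _).pow _).ne_zero,
      Multiset.count_bind]
    simp only [Finset.sum_map_val]
    refine Finset.sum_congr rfl fun j _ => ?_
    rw [roots_pow, roots_X_sub_C, Multiset.count_nsmul, Multiset.count_singleton]
    simp [eq_comm]
  have hcount' : ∀ μ, T.charpoly.roots.count μ = finrank k (T.eigenspace μ) := by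
    intro μ
    rw [count_roots, ← LinearMap.finrank_maxGenEigenspace_eq, H.maxGenEigenspace_eq]
  have hle : T.charpoly.roots ≤ R.roots := by
    rw [Multiset.le_iff_count]
    intro μ
    rw [hcount, hcount']
    exact H.finrank_eigenspace_le μ
  have hsplit : T.charpoly.Splits := by
    rw [splits_iff_card_roots]
    refine le_antisymm (card_roots' _) ?_
    rw [LinearMap.charpoly_natDegree]
    calc finrank k V = finrank k (⨆ μ ∈ exponents k e, T.eigenspace μ : Submodule k V) := by
          rw [H.biSup_eigenspace_eq_top, finrank_top]
      _ ≤ ∑ μ ∈ exponents k e, finrank k (T.eigenspace μ) := by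
          exact finrank_biSup_le _ _
      _ ≤ T.charpoly.roots.card := by
          simp only [← hcount']
          exact Multiset.sum_count_le_card _ _
  refine (eq_of_monic_of_dvd_of_natDegree_le (LinearMap.charpoly_monic T) hmonic ?_ ?_).symm
  · rw [hsplit.eq_prod_roots_of_monic (LinearMap.charpoly_monic T)]
    exact (Multiset.prod_dvd_prod_of_le (Multiset.map_le_map hle)).trans
      (prod_multiset_X_sub_C_dvd R)
  · rw [LinearMap.charpoly_natDegree, ← hd, hR, natDegree_prod_of_monic _ _
      fun P _ => monic_prod_of_monic _ _ fun j _ => (monic_X_sub_C _).pow _]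
    refine Finset.sum_le_sum fun P _ => ?_
    rw [natDegree_prod_of_monic _ _ fun j _ => (monic_X_sub_C _).pow _]
    simp

/-- The other eigenspaces are in the image of `T`, hence in all `F P 1`, and an eigenvector for `0`
in all `F P 1` climbs up to all `F P (e P)`. -/
theorem genEigenProj_zero_eq_zero_iff [CharZero k] [Fintype ι] (he : ∀ P, 0 < e P)
    (h : HasGenEigenDecomposition T) (v : V) :
    genEigenProj T h 0 v = 0 ↔ ∀ P, v ∈ H.F P 1 := by
  classical
  have hT : ∀ (w : V) P, T w ∈ H.F P 1 := fun w P => by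
    simpa using H.sub_mem P 0 (he P) w (by simp [H.F_zero])
  have hEig : ∀ (μ : k) (w : T.maxGenEigenspace μ), T w = μ • (w : V) := fun μ w =>
    Module.End.mem_eigenspace_iff.1 (H.maxGenEigenspace_eq μ ▸ w.2)
  let x := (Equiv.ofBijective _ h).symm v
  have hv : v = ∑ μ ∈ x.support, (x μ : V) := by
    have h1 : DirectSum.coeAddMonoidHom (fun μ : k => T.maxGenEigenspace μ) x = v :=
      (Equiv.ofBijective _ h).apply_symm_apply v
    rw [DirectSum.coeAddMonoidHom_eq_dfinsuppSum] at h1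
    exact h1.symm
  have hrest : ∀ P, v - (x 0 : V) ∈ H.F P 1 := by
    intro P
    have hsplit : v - (x 0 : V) = ∑ μ ∈ x.support.erase 0, (x μ : V) := by
      by_cases h0 : (0 : k) ∈ x.support
      · rw [hv, ← Finset.add_sum_erase _ _ h0, add_sub_cancel_left]
      · rw [Finset.erase_eq_of_notMem h0, ← hv, DFinsupp.notMem_support_iff.1 h0]
        simp
    rw [hsplit]
    refine Submodule.sum_mem _ fun μ hμ => ?_
    have hne : μ ≠ 0 := Finset.ne_of_mem_erase hμ
    have := Submodule.smul_mem _ μ⁻¹ (hT (x μ) P)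
    rwa [hEig, smul_smul, inv_mul_cancel₀ hne, one_smul] at this
  have hproj : genEigenProj T h 0 v = x 0 := rfl
  rw [hproj]
  constructor
  · intro h0 P
    simpa [h0] using hrest P
  · intro hvF
    have key : ∀ P j, j < e P → (x 0 : V) ∈ H.F P (j + 1) := by
      intro P j
      induction j with
      | zero =>
        intro _
        simpa using Submodule.sub_mem _ (hvF P) (hrest P)
      | succ j ih =>
        intro hj
        refine H.F_stable_succ hj (ih (by omega)) (hEig 0 (x 0)) ?_
        have : (e P : k) ≠ 0 := Nat.cast_ne_zero.2 (by omega)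
        exact (div_ne_zero (by exact_mod_cast Nat.succ_ne_zero j) this).symm
    refine Subtype.ext (H.eq_zero _ fun P => ?_)
    have := key P (e P - 1) (by have := he P; omega)
    rwa [Nat.sub_add_cancel (he P)] at this

end ExponentFiltration

end Exponents

/-! ### Derivations and discrete valuations in characteristic zero -/

section Local

open WithZero

theorem WithZero.lt_exp_iff_le_exp_sub_one {x : ℤᵐ⁰} {n : ℤ} :
    x < WithZero.exp n ↔ x ≤ WithZero.exp (n - 1) := by
  rw [← lt_mul_exp_iff_le exp_ne_zero, ← exp_add, sub_add_cancel]

variable {k K κ : Type*} [Field k] [Field K] [Algebra k K] [CommRing κ] [Algebra k κ]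
  {v : Valuation K ℤᵐ⁰}

/-- Reduction of the valuation ring of `v` to the `k`-algebra `κ`, as a function on all of `K`
whose values outside of the valuation ring are irrelevant. -/
structure ResidueMap (k : Type*) {K : Type*} [Field k] [Field K] [Algebra k K]
    (v : Valuation K ℤᵐ⁰) (κ : Type*) [CommRing κ] [Algebra k κ] where
  toFun : K → κ
  toFun_add : ∀ f g, v f ≤ 1 → v g ≤ 1 → toFun (f + g) = toFun f + toFun g
  toFun_mul : ∀ f g, v f ≤ 1 → v g ≤ 1 → toFun (f * g) = toFun f * toFun g
  val_algebraMap : ∀ c : k, v (algebraMap k K c) ≤ 1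
  toFun_algebraMap : ∀ c : k, toFun (algebraMap k K c) = algebraMap k κ c
  eq_zero_iff : ∀ f, v f ≤ 1 → (toFun f = 0 ↔ v f < 1)

namespace ResidueMap

variable (ρ : ResidueMap k v κ)

include ρ in
theorem val_algebraMap_of_ne_zero {c : k} (hc : c ≠ 0) : v (algebraMap k K c) = 1 := by
  refine le_antisymm (ρ.val_algebraMap c) ?_
  have h : v (algebraMap k K c) * v (algebraMap k K c⁻¹) = 1 := by
    rw [← map_mul, ← map_mul, mul_inv_cancel₀ hc, map_one, map_one]
  calc (1 : ℤᵐ⁰) = v (algebraMap k K c) * v (algebraMap k K c⁻¹) := h.symm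
    _ ≤ v (algebraMap k K c) * 1 := by gcongr; exact ρ.val_algebraMap _
    _ = _ := mul_one _

include ρ in
theorem val_smul_le (c : k) {f : K} {g : ℤᵐ⁰} (hf : v f ≤ g) : v (c • f) ≤ g := by
  rw [Algebra.smul_def, map_mul]
  calc _ ≤ 1 * v f := by gcongr; exact ρ.val_algebraMap c
    _ ≤ g := by rwa [one_mul]

theorem toFun_zero : ρ.toFun 0 = 0 := by
  simpa using ρ.toFun_algebraMap 0

theorem toFun_one : ρ.toFun 1 = 1 := by
  simpa using ρ.toFun_algebraMap 1

theorem toFun_smul (c : k) {f : K} (hf : v f ≤ 1) : ρ.toFun (c • f) = c • ρ.toFun f := by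
  rw [Algebra.smul_def, ρ.toFun_mul _ _ (ρ.val_algebraMap c) hf, ρ.toFun_algebraMap,
    ← Algebra.smul_def]

theorem isUnit_of_val_eq_one {f : K} (hf : v f = 1) : IsUnit (ρ.toFun f) := by
  have h0 : f ≠ 0 := by rintro rfl; simp at hf
  refine IsUnit.of_mul_eq_one (ρ.toFun f⁻¹) ?_
  rw [← ρ.toFun_mul _ _ hf.le (by simp [hf]), mul_inv_cancel₀ h0, ρ.toFun_one]

theorem aeval_spec {f : K} (hf : v f ≤ 1) (p : k[X]) :
    v (aeval f p) ≤ 1 ∧ ρ.toFun (aeval f p) = aeval (ρ.toFun f) p := by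
  induction p using Polynomial.induction_on with
  | C a => simp [ρ.val_algebraMap, ρ.toFun_algebraMap]
  | add p q hp hq =>
    rw [map_add (aeval f), map_add (aeval (ρ.toFun f)), ρ.toFun_add _ _ hp.1 hq.1,
      hp.2, hq.2]
    exact ⟨v.map_add_le hp.1 hq.1, rfl⟩
  | monomial n a h =>
    rw [pow_succ, ← mul_assoc, map_mul (aeval f), map_mul (aeval (ρ.toFun f)),
      aeval_X, aeval_X, ρ.toFun_mul _ _ h.1 hf, h.2, map_mul v]
    exact ⟨mul_le_one' h.1 hf, rfl⟩

end ResidueMap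

theorem Valuation.eq_zpow_mul_of_le_exp {z : K} (hz : v z = exp (-1)) {f : K} {i : ℤ}
    (hf : v f ≤ exp (-i)) : ∃ g, v g ≤ 1 ∧ f = z ^ i * g := by
  have hz0 : z ≠ 0 := by rintro rfl; simp at hz; exact exp_ne_zero hz.symm
  have hzi : v (z ^ (-i)) = exp i := by
    rw [map_zpow₀, hz, ← exp_zsmul, smul_eq_mul]; congr 1; ring
  refine ⟨z ^ (-i) * f, ?_, ?_⟩
  · rw [map_mul, hzi]
    calc _ ≤ exp i * exp (-i) := by gcongr
      _ = 1 := by rw [← exp_add, add_neg_cancel, exp_zero]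
  · rw [← mul_assoc, ← zpow_add₀ hz0, add_neg_cancel, zpow_zero, one_mul]

/-- A derivation of `K` whose poles on the valuation ring are bounded takes its worst pole there at
a uniformizer. Indeed if `g` is the minimal polynomial of the residue of `f`, then `g(f)` is a
multiple `z * f₁` of the uniformizer, so that `g'(f) * ∂ f = f₁ * ∂ z + z * ∂ f₁`, where `g'(f)` is
a unit by separability. -/
theorem ResidueMap.val_derivation_le [CharZero k] [IsDomain κ] [Algebra.IsIntegral k κ]
    (ρ : ResidueMap k v κ) (d : Derivation k K K) {z : K} (hz : v z = exp (-1)) (h0 : d ≠ 0)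
    (hM : ∃ M : ℤ, ∀ f, v f ≤ 1 → v (d f) ≤ exp M) {f : K} (hf : v f ≤ 1) :
    v (d f) ≤ v (d z) := by
  have hz1 : v z < 1 := by rw [hz, ← exp_zero]; exact exp_lt_exp.2 (by norm_num)
  obtain ⟨f₀, hf₀, hdf₀⟩ : ∃ f, v f ≤ 1 ∧ d f ≠ 0 := by
    by_contra! h
    refine h0 (Derivation.ext fun f => ?_)
    rcases le_total (v f) 1 with hf | hf
    · exact h f hf
    · have h1 := h f⁻¹ (by rw [map_inv₀]; exact inv_le_one_of_one_le₀ hf)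
      simpa using (d.leibniz_inv f⁻¹).trans (by rw [h1, smul_zero])
  obtain ⟨N, hN, hmin⟩ := Int.exists_least_of_bdd
    (P := fun M : ℤ => ∀ f, v f ≤ 1 → v (d f) ≤ exp M)
    ⟨(v (d f₀)).log, fun M h => (log_le_iff_le_exp ((v.ne_zero_iff).2 hdf₀)).2 (h f₀ hf₀)⟩ hM
  refine (hN f hf).trans ?_
  by_contra! hlt
  rw [lt_exp_iff_le_exp_sub_one] at hlt
  have := hmin (N - 1) fun f hf => by
    have ha : IsIntegral k (ρ.toFun f) := Algebra.IsIntegral.isIntegral _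
    set g := minpoly k (ρ.toFun f) with hg
    have hsep : g.Separable := (minpoly.irreducible ha).separable
    have h1 := ρ.aeval_spec hf g
    have h2 := ρ.aeval_spec hf (derivative g)
    rw [hg, minpoly.aeval, ρ.eq_zero_iff _ (by rw [← hg]; exact h1.1), ← hg, ← exp_zero,
      lt_exp_iff_le_exp_sub_one, zero_sub] at h1
    obtain ⟨f₁, hf₁, he⟩ := v.eq_zpow_mul_of_le_exp hz h1.2
    rw [zpow_one] at he
    have h3 : v (aeval f (derivative g)) = 1 := by
      refine le_antisymm h2.1 (not_lt.1 fun hlt => ?_)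
      rw [← ρ.eq_zero_iff _ h2.1, h2.2] at hlt
      exact hsep.aeval_derivative_ne_zero (minpoly.aeval k (ρ.toFun f)) hlt
    have h4 : aeval f (derivative g) * d f = f₁ * d z + z * d f₁ := by
      rw [← smul_eq_mul, ← d.map_aeval, he, d.leibniz, smul_eq_mul, smul_eq_mul]; ring
    have h5 : v (d f) = v (f₁ * d z + z * d f₁) := by
      rw [← h4, map_mul, h3, one_mul]
    rw [h5]
    refine v.map_add_le ?_ ?_
    · rw [map_mul]
      calc _ ≤ 1 * exp (N - 1) := by gcongr
        _ = _ := one_mul _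
    · rw [map_mul, hz]
      calc _ ≤ exp (-1) * exp N := by gcongr; exact hN f₁ hf₁
        _ = _ := by rw [← exp_add]; congr 1; ring
  omega

/-- The derivation `z d/dz` acts on functions of order `≥ i` as multiplication by `i`, up to
functions of order `> i`. -/
theorem val_uniformizer_mul_derivation_sub_le (D : Derivation k K K) {z : K}
    (hz : v z = exp (-1)) (hDz : D z = 1) (hD : ∀ f, v f ≤ 1 → v (D f) ≤ 1) {i : ℤ} {f : K}
    (hf : v f ≤ exp (-i)) : v (z * D f - i * f) ≤ exp (-i - 1) := by
  have hz0 : z ≠ 0 := by rintro rfl; simp at hz; exact exp_ne_zero hz.symm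
  obtain ⟨g, hg, rfl⟩ := v.eq_zpow_mul_of_le_exp hz hf
  have h : z * D (z ^ i * g) - i * (z ^ i * g) = z ^ (i + 1) * D g := by
    rw [D.leibniz, D.leibniz_zpow, hDz, zpow_sub_one₀ hz0, zpow_add_one₀ hz0]
    simp only [smul_eq_mul, zsmul_eq_mul]
    field_simp
    ring
  rw [h, map_mul, map_zpow₀, hz, ← exp_zsmul]
  calc _ ≤ exp ((i + 1) • (-1)) * 1 := by gcongr; exact hD g hg
    _ = _ := by rw [mul_one, smul_eq_mul]; congr 1; ring

/-- The derivation `t d/dt` acts on functions of order `≥ i` as multiplication by `i / e`, up to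
functions of order `> i`, where `e` is the order of `t`. -/
theorem ResidueMap.val_logDerivation_sub_le [CharZero k] (ρ : ResidueMap k v κ)
    (D Θ : Derivation k K K) {z t : K} {e : ℕ} (he : 0 < e) (hz : v z = exp (-1)) (hDz : D z = 1)
    (hD : ∀ f, v f ≤ 1 → v (D f) ≤ 1) (ht : v t = exp (-(e : ℤ)))
    (hΘ : ∀ f, Θ f * D t = t * D f) {i : ℤ} {f : K}
    (hf : v f ≤ exp (-i)) : v (Θ f - ((i : k) / (e : k)) • f) ≤ exp (-i - 1) := by
  have ht0 : t ≠ 0 := by rintro rfl; simp at ht; exact exp_ne_zero ht.symm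
  have hz0 : z ≠ 0 := by rintro rfl; simp at hz; exact exp_ne_zero hz.symm
  have hek : (e : k) ≠ 0 := Nat.cast_ne_zero.2 he.ne'
  have heK : (e : K) ≠ 0 := by
    rw [← map_natCast (algebraMap k K)]
    exact (map_ne_zero_iff _ (algebraMap k K).injective).2 hek
  have hve : v (e : K) = 1 := by
    rw [← map_natCast (algebraMap k K)]; exact ρ.val_algebraMap_of_ne_zero hek
  have hA := val_uniformizer_mul_derivation_sub_le D hz hDz hD ht.le
  have hB := val_uniformizer_mul_derivation_sub_le D hz hDz hD hf
  -- The logarithmic derivative `q = z t' / t` is the constant `e` up to higher order terms.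
  set q := z * D t / t with hq
  have hqe : v (q - e) ≤ exp (-1) := by
    have h : q - e = (z * D t - ((e : ℤ) : K) * t) * t⁻¹ := by
      rw [hq]; field_simp; push_cast; ring
    rw [h, map_mul, map_inv₀, ht, ← exp_neg]
    calc _ ≤ exp (-(e : ℤ) - 1) * exp (- -(e : ℤ)) := by gcongr
      _ = _ := by rw [← exp_add]; congr 1; ring
  have hq1 : v q = 1 := by
    have h := v.map_add_eq_of_lt_left (x := (e : K)) (y := q - e) (by
      rw [hve]
      exact hqe.trans_lt (by rw [← exp_zero]; exact exp_lt_exp.2 (by norm_num)))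
    rwa [add_sub_cancel, hve] at h
  have hq0 : q ≠ 0 := by intro h; rw [h] at hq1; simp at hq1
  have hDt : D t ≠ 0 := by intro h; rw [hq, h] at hq0; simp at hq0
  have hfin : Θ f - ((i : k) / (e : k)) • f =
      (z * D f - i * f) * q⁻¹ - ((i : k) / (e : k)) • (f * ((q - e) * q⁻¹)) := by
    have h1 : Θ f = z * D f * q⁻¹ := by
      rw [eq_div_of_mul_eq hDt (hΘ f), hq]; field_simp
    rw [h1, Algebra.smul_def, Algebra.smul_def, map_div₀, map_intCast, map_natCast]
    field_simp
    ring
  rw [hfin]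
  refine v.map_sub_le ?_ (ρ.val_smul_le _ ?_)
  · rw [map_mul, map_inv₀, hq1, inv_one, mul_one]
    exact hB
  · rw [map_mul, map_mul, map_inv₀, hq1, inv_one, mul_one]
    calc _ ≤ exp (-i) * exp (-1) := by gcongr
      _ = _ := by rw [← exp_add]; congr 1

/-- Every function is the sum of a regular function and of a logarithmic derivative: the polar part
of `f` of order `n > 0` is that of `Θ (-(e / n) • f)`. -/
theorem ResidueMap.exists_val_sub_le_one [CharZero k] (ρ : ResidueMap k v κ)
    (Θ : Derivation k K K) {e : ℕ} (he : 0 < e)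
    (hΘ : ∀ (i : ℤ) (f : K), v f ≤ exp (-i) → v (Θ f - ((i : k) / (e : k)) • f) ≤ exp (-i - 1))
    (f : K) : ∃ h, v (f - Θ h) ≤ 1 := by
  have hek : (e : k) ≠ 0 := Nat.cast_ne_zero.2 he.ne'
  have key : ∀ (n : ℕ) (f : K), v f ≤ exp (n : ℤ) → ∃ h, v (f - Θ h) ≤ 1 := by
    intro n
    induction n with
    | zero => intro f hf; exact ⟨0, by simpa using hf⟩
    | succ n ih =>
      intro f hf
      have hn : ((n : k) + 1) ≠ 0 := Nat.cast_add_one_ne_zero n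
      have h1 := hΘ (-((n : ℤ) + 1)) f (by simpa using hf)
      set c : k := (e : k) / ((n : k) + 1) with hc
      have h2 : v (f + c • Θ f) ≤ exp (n : ℤ) := by
        have h3 : f + c • Θ f =
            c • (Θ f - (((-((n : ℤ) + 1) : ℤ) : k) / (e : k)) • f) := by
          rw [smul_sub, smul_smul, hc]
          have : (e : k) / ((n : k) + 1) * (((-((n : ℤ) + 1) : ℤ) : k) / (e : k)) = -1 := by
            push_cast
            field_simp
          rw [this, neg_one_smul]; ring
        rw [h3]
        refine ρ.val_smul_le _ (h1.trans (le_of_eq ?_))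
        congr 1; ring
      obtain ⟨h, hh⟩ := ih _ h2
      refine ⟨h - c • f, ?_⟩
      convert hh using 2
      rw [map_sub, Derivation.map_smul]; ring
  refine key (v f).log.toNat f (le_exp_of_log_le (Int.self_le_toNat _))

end Local

/-! ### The Euler operator on Laurent series -/

section Euler

variable {κ : Type*} [CommRing κ]

/-- The Euler operator `T d/dT` on Laurent series in `T`. -/
def LaurentSeries.euler (f : LaurentSeries κ) : LaurentSeries κ where
  coeff n := (n : κ) * f.coeff n
  isPWO_support' := f.isPWO_support.mono fun n hn h => hn (by simp [h])

namespace LaurentSeries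

@[simp]
theorem euler_coeff (f : LaurentSeries κ) (n : ℤ) : (euler f).coeff n = (n : κ) * f.coeff n := rfl

theorem euler_add (f g : LaurentSeries κ) : euler (f + g) = euler f + euler g := by
  ext n; simp [mul_add]

theorem support_euler_subset (f : LaurentSeries κ) : (euler f).support ⊆ f.support :=
  fun n hn h => hn (by simp [h])

theorem euler_mul (f g : LaurentSeries κ) : euler (f * g) = f * euler g + g * euler f := by
  ext n
  rw [mul_comm g, HahnSeries.coeff_add, euler_coeff, HahnSeries.coeff_mul,
    HahnSeries.coeff_mul_right' g.isPWO_support (support_euler_subset g),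
    HahnSeries.coeff_mul_left' f.isPWO_support (support_euler_subset f), Finset.mul_sum,
    ← Finset.sum_add_distrib]
  refine Finset.sum_congr rfl fun ij hij => ?_
  rw [Finset.mem_antidiagonal] at hij
  rw [euler_coeff, euler_coeff, ← hij.2.2]
  push_cast
  ring

theorem euler_single (n : ℤ) (c : κ) :
    euler (HahnSeries.single n c) = HahnSeries.single n ((n : κ) * c) := by
  ext m
  by_cases h : m = n
  · subst h; simp
  · simp [HahnSeries.coeff_single_of_ne h]

theorem euler_algebraMap {k : Type*} [CommRing k] [Algebra k κ] (c : k) :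
    euler (algebraMap k (LaurentSeries κ) c) = 0 := by
  rw [HahnSeries.algebraMap_apply', PowerSeries.algebraMap_apply, HahnSeries.ofPowerSeries_C,
    HahnSeries.C_apply, euler_single]
  simp

/-- The Euler operator preserves power series, and the result has no constant term. -/
theorem exists_euler_ofPowerSeries (s : PowerSeries κ) :
    ∃ s' : PowerSeries κ, euler (s : LaurentSeries κ) = s' ∧ PowerSeries.constantCoeff s' = 0 := by
  refine ⟨PowerSeries.X * PowerSeries.derivative κ s, ?_, by simp⟩
  ext n
  rw [euler_coeff, PowerSeries.coeff_coe, PowerSeries.coeff_coe]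
  split_ifs with hn
  · simp
  · obtain ⟨m, rfl⟩ := Int.eq_ofNat_of_zero_le (not_lt.1 hn)
    cases m with
    | zero => simp
    | succ m =>
      rw [Int.natAbs_natCast, PowerSeries.coeff_succ_X_mul,
        PowerSeries.coeff_derivative]
      push_cast
      ring

end LaurentSeries

/-- As every derivation of `K` is a multiple of `d`, so is the composition of an embedding `φ` of
`K` into an algebra with a derivation `E` of that algebra. -/
theorem AlgHom.derivation_apply_eq {k K L : Type*} [Field k] [Field K] [Algebra k K] [CommRing L]
    [Algebra k L] (φ : K →ₐ[k] L) (E : L → L) (hadd : ∀ a b, E (a + b) = E a + E b)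
    (hmul : ∀ a b, E (a * b) = a * E b + b * E a) (hconst : ∀ c, E (algebraMap k L c) = 0)
    (d : Derivation k K K) (x : K) (hd : ∀ f, D k K f = d f • D k K x) (f : K) :
    E (φ f) = φ (d f) * E (φ x) := by
  let : Module K L := Module.compHom _ (φ : K →+* L)
  have hsmul : ∀ (a : K) (m : L), a • m = φ a * m := fun _ _ => rfl
  have : IsScalarTower k K L := ⟨fun c a m => by
    rw [hsmul, hsmul, map_smul, smul_mul_assoc]⟩
  let δ : Derivation k K L := Derivation.mk'
    { toFun := fun f => E (φ f)
      map_add' := fun f g => by rw [map_add, hadd]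
      map_smul' := fun c f => by
        rw [map_smul, Algebra.smul_def, hmul, hconst, mul_zero, add_zero, RingHom.id_apply,
          ← Algebra.smul_def] }
    fun a b => by
      change E (φ (a * b)) = φ a * E (φ b) + φ b * E (φ a)
      rw [map_mul, hmul]
  have h := congrArg δ.liftKaehlerDifferential (hd f)
  rw [map_smul, Derivation.liftKaehlerDifferential_comp_D,
    Derivation.liftKaehlerDifferential_comp_D] at h
  exact h

theorem LaurentSeries.euler_map {k K : Type*} [Field k] [Field K] [Algebra k K] [Algebra k κ]
    (φ : K →ₐ[k] LaurentSeries κ) (d : Derivation k K K) (x : K)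
    (hd : ∀ f, D k K f = d f • D k K x) (f : K) :
    euler (φ f) = φ (d f) * euler (φ x) :=
  φ.derivation_apply_eq euler euler_add euler_mul euler_algebraMap d x hd f

end Euler

/-! ### Residues at a discrete valuation -/

section Residue

open WithZero

variable {k K κ : Type*} [Field k] [Field K] [Algebra k K] [CommRing κ] [Algebra k κ]
  {v : Valuation K ℤᵐ⁰} (ρ : ResidueMap k v κ)

/-- `φ` maps functions regular for `v` to power series whose constant term is their
value in `κ`. -/
def ResidueMap.IsExpansion (ρ : ResidueMap k v κ) (φ : K →ₐ[k] LaurentSeries κ) : Prop :=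
  ∀ f, v f ≤ 1 → ∃ s : PowerSeries κ, φ f = (s : LaurentSeries κ) ∧
    PowerSeries.constantCoeff s = ρ.toFun f

variable {ρ}

/-- The function that is expanded as the variable is a uniformizer. -/
theorem ResidueMap.IsExpansion.val_eq_of_map_eq_single [Nontrivial κ]
    {φ : K →ₐ[k] LaurentSeries κ} (hφ : ρ.IsExpansion φ) {π : K} (hπ : v π = exp (-1)) {z : K}
    (hz : φ z = HahnSeries.single 1 1) : v z = exp (-1) := by
  have hX : φ z = ((PowerSeries.X : PowerSeries κ) : LaurentSeries κ) := by
    rw [hz, PowerSeries.coe_X]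
  have hinj := HahnSeries.ofPowerSeries_injective (Γ := ℤ) (R := κ)
  have hz0 : z ≠ 0 := by
    rintro rfl
    rw [map_zero] at hz
    have := congrArg (fun s : LaurentSeries κ => s.coeff 1) hz
    simp at this
  have hlt : v z < 1 := by
    by_contra! h
    obtain ⟨s, hs, -⟩ := hφ z⁻¹ (by rw [map_inv₀]; exact inv_le_one_of_one_le₀ h)
    have h1 : PowerSeries.X * s = 1 := by
      apply hinj
      rw [map_mul, ← hX, ← hs, ← map_mul, mul_inv_cancel₀ hz0, map_one, map_one]
    have := congrArg PowerSeries.constantCoeff h1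
    simp at this
  rw [← exp_zero, lt_exp_iff_le_exp_sub_one, zero_sub] at hlt
  obtain ⟨w, hw, rfl⟩ := v.eq_zpow_mul_of_le_exp hπ hlt
  rw [zpow_one] at hX ⊢
  have hπ1 : v π < 1 := by rw [hπ, ← exp_zero]; exact exp_lt_exp.2 (by norm_num)
  obtain ⟨p, hp, hp0⟩ := hφ π hπ1.le
  obtain ⟨s, hs, hs0⟩ := hφ w hw
  rw [(ρ.eq_zero_iff π hπ1.le).2 hπ1] at hp0
  have h1 : p * s = PowerSeries.X := by
    apply hinj
    rw [map_mul, ← hp, ← hs, ← map_mul, hX]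
  have h2 := congrArg (PowerSeries.coeff 1) h1
  rw [PowerSeries.coeff_mul, Finset.Nat.antidiagonal_succ] at h2
  simp [hp0, hs0] at h2
  have h3 : v w = 1 := by
    refine le_antisymm hw (not_lt.1 fun hlt => ?_)
    rw [(ρ.eq_zero_iff w hw).2 hlt, mul_zero] at h2
    exact zero_ne_one h2
  rw [map_mul, h3, hπ, mul_one]

/-- The logarithmic derivative of the expansion of a function of order `e` has constant term `e`,
so that the residue of `(a + Θ h) dt / t`, where `Θ = t d/dt`, is `e` times the value of `a`. -/
theorem ResidueMap.IsExpansion.coeff_eq [Nontrivial κ]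
    {φ : K →ₐ[k] LaurentSeries κ} (hφ : ρ.IsExpansion φ) {π : K} (hπ : v π = exp (-1)) {z : K}
    (hz : φ z = HahnSeries.single 1 1) {t : K} {e : ℕ} (ht : v t = exp (-(e : ℤ)))
    (Θ : Derivation k K K)
    (hΘ : ∀ f, LaurentSeries.euler (φ f) * φ t = φ (Θ f) * LaurentSeries.euler (φ t))
    {f a h : K} (ha : v a ≤ 1) (hf : f * Θ z = a + Θ h) :
    (φ f).coeff (-1) = (e : κ) * ρ.toFun a := by
  have hvz := hφ.val_eq_of_map_eq_single hπ hz
  obtain ⟨u, hu, hut⟩ := v.eq_zpow_mul_of_le_exp hvz ht.le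
  rw [zpow_natCast] at hut
  have hz0 : z ≠ 0 := by rintro rfl; simp at hvz; exact exp_ne_zero hvz.symm
  have ht0 : t ≠ 0 := by rintro rfl; simp at ht; exact exp_ne_zero ht.symm
  have hu0 : u ≠ 0 := by rintro rfl; simp at hut; exact ht0 hut
  have hu1 : v u = 1 := by
    rw [hut, map_mul, map_pow, hvz, ← exp_nsmul] at ht
    simpa using ht
  -- `ℓ` is the logarithmic derivative of the expansion of `t`.
  obtain ⟨s, hs, -⟩ := hφ u hu
  obtain ⟨s', hs', -⟩ := hφ u⁻¹ (by simp [hu1])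
  obtain ⟨s'', hs'', hs''0⟩ := LaurentSeries.exists_euler_ofPowerSeries s
  have hpow : ∀ n : ℕ, LaurentSeries.euler (φ z ^ n) = (n : LaurentSeries κ) * φ z ^ n := by
    intro n
    have hC : (n : LaurentSeries κ) = HahnSeries.single 0 (n : κ) :=
      (map_natCast (HahnSeries.C (Γ := ℤ) (R := κ)) n).symm
    rw [hz, HahnSeries.single_pow, LaurentSeries.euler_single, hC, HahnSeries.single_mul_single]
    simp
  set L : LaurentSeries κ := (e : LaurentSeries κ) + φ u⁻¹ * (s'' : LaurentSeries κ) with hL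
  have hEt : LaurentSeries.euler (φ t) = φ t * L := by
    rw [hut, map_mul, map_pow, LaurentSeries.euler_mul, hpow, hL, hs, hs'', ← hs]
    have : φ u * φ u⁻¹ = 1 := by rw [← map_mul, mul_inv_cancel₀ hu0, map_one]
    linear_combination (- φ z ^ e * (s'' : LaurentSeries κ)) * this
  have hcancel : ∀ {A B : LaurentSeries κ}, A * φ t = B * φ t → A = B := by
    intro A B hAB
    have : φ t * φ t⁻¹ = 1 := by rw [← map_mul, mul_inv_cancel₀ ht0, map_one]
    linear_combination φ t⁻¹ * hAB - (A - B) * this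
  have hE : ∀ g, LaurentSeries.euler (φ g) = φ (Θ g) * L := fun g =>
    hcancel (by rw [hΘ, hEt]; ring)
  have h1 : φ f * φ z = φ a * L + LaurentSeries.euler (φ h) := by
    have h2 : φ z = φ (Θ z) * L := by
      rw [← hE]; simpa using (hpow 1).symm
    rw [hE, h2, ← mul_assoc, ← map_mul, hf, map_add]; ring
  have h3 : (φ f).coeff (-1) = (φ f * φ z).coeff 0 := by
    rw [hz]
    simpa using (HahnSeries.coeff_mul_single_add (r := (1 : κ)) (x := φ f) (a := -1)
      (b := (1 : ℤ))).symm
  obtain ⟨p, hp, hp0⟩ := hφ a ha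
  have h4 : φ a * L = ((p * ((e : PowerSeries κ) + s' * s'') : PowerSeries κ) :
      LaurentSeries κ) := by
    rw [hL, hp, hs']
    simp [PowerSeries.coe_mul]
  rw [h3, h1, HahnSeries.coeff_add, h4, PowerSeries.coeff_coe]
  simp [hp0, hs''0, mul_comm]

end Residue

/-! ### Taylor expansions -/

section Taylor

open WithZero

variable {k K κ : Type*} [Field k] [Field K] [Algebra k K] [CommRing κ] [Algebra k κ]
  {v : Valuation K ℤᵐ⁰} (ρ : ResidueMap k v κ)

/-- The Taylor series of `f` with respect to the derivation `D`, with coefficients in `κ`. -/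
def ResidueMap.taylor (D : Derivation k K K) (f : K) : PowerSeries κ :=
  PowerSeries.mk fun n => ((n.factorial : k)⁻¹) • ρ.toFun (D^[n] f)

namespace ResidueMap

variable {D : Derivation k K K}

theorem constantCoeff_taylor (f : K) :
    PowerSeries.constantCoeff (ρ.taylor D f) = ρ.toFun f := by
  rw [← PowerSeries.coeff_zero_eq_constantCoeff_apply, taylor, PowerSeries.coeff_mk]
  simp

theorem derivative_taylor [CharZero k] (f : K) :
    PowerSeries.derivative κ (ρ.taylor D f) = ρ.taylor D (D f) := by
  ext n
  rw [PowerSeries.coeff_derivative, taylor, taylor, PowerSeries.coeff_mk, PowerSeries.coeff_mk,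
    Function.iterate_succ_apply, mul_comm, ← Nat.cast_succ, ← nsmul_eq_mul, ← Nat.cast_smul_eq_nsmul k,
    smul_smul, Nat.factorial_succ]
  congr 1
  have h1 : ((n + 1 : ℕ) : k) ≠ 0 := Nat.cast_ne_zero.2 n.succ_ne_zero
  have h2 : (n.factorial : k) ≠ 0 := Nat.cast_ne_zero.2 n.factorial_ne_zero
  push_cast at h1 ⊢
  field_simp

variable (hD : ∀ f, v f ≤ 1 → v (D f) ≤ 1)
include hD

omit [CommRing κ] [Algebra k κ] in
theorem val_iterate_le {f : K} (hf : v f ≤ 1) (n : ℕ) : v (D^[n] f) ≤ 1 := by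
  induction n with
  | zero => exact hf
  | succ n ih => rw [Function.iterate_succ_apply']; exact hD _ ih

theorem taylor_add {f g : K} (hf : v f ≤ 1) (hg : v g ≤ 1) :
    ρ.taylor D (f + g) = ρ.taylor D f + ρ.taylor D g := by
  ext n
  rw [map_add, taylor, taylor, taylor, PowerSeries.coeff_mk, PowerSeries.coeff_mk,
    PowerSeries.coeff_mk, ← smul_add, iterate_map_add,
    ρ.toFun_add _ _ (val_iterate_le hD hf n) (val_iterate_le hD hg n)]

/-- Multiplicativity of Taylor series, without the iterated Leibniz formula: both sides have the
same constant term, and by induction their derivatives agree up to any order. -/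
theorem taylor_mul [CharZero k] {f g : K} (hf : v f ≤ 1) (hg : v g ≤ 1) :
    ρ.taylor D (f * g) = ρ.taylor D f * ρ.taylor D g := by
  have key : ∀ (n : ℕ) (f g : K), v f ≤ 1 → v g ≤ 1 →
      PowerSeries.coeff n (ρ.taylor D (f * g)) =
        PowerSeries.coeff n (ρ.taylor D f * ρ.taylor D g) := by
    intro n
    induction n with
    | zero =>
      intro f g hf hg
      simp [constantCoeff_taylor, ρ.toFun_mul _ _ hf hg]
    | succ n ih =>
      intro f g hf hg
      have hunit : IsUnit ((n : κ) + 1) := by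
        have : ((n : κ) + 1) = algebraMap k κ ((n : k) + 1) := by simp
        rw [this]
        exact (IsUnit.mk0 _ (Nat.cast_add_one_ne_zero n)).map _
      refine hunit.mul_right_cancel ?_
      rw [← PowerSeries.coeff_derivative, ← PowerSeries.coeff_derivative, Derivation.leibniz,
        derivative_taylor, derivative_taylor, derivative_taylor, D.leibniz]
      simp only [smul_eq_mul]
      have hmul : ∀ {a b : K}, v a ≤ 1 → v b ≤ 1 → v (a * b) ≤ 1 := fun ha hb => by
        rw [map_mul]; exact mul_le_one' ha hb
      rw [ρ.taylor_add hD (hmul hf (hD g hg)) (hmul hg (hD f hf)), map_add, map_add,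
        ih _ _ hf (hD g hg), ih _ _ hg (hD f hf)]
  ext n
  exact key n f g hf hg

omit hD in
theorem taylor_algebraMap (c : k) :
    ρ.taylor D (algebraMap k K c) = algebraMap k (PowerSeries κ) c := by
  ext n
  rw [taylor, PowerSeries.coeff_mk, PowerSeries.algebraMap_apply, PowerSeries.coeff_C]
  cases n with
  | zero => simp [ρ.toFun_algebraMap]
  | succ n =>
    have : D^[n] 0 = 0 := iterate_map_zero D n
    simp [Function.iterate_succ_apply, this, ρ.toFun_zero]

omit hD in
theorem taylor_eq_X {z : K} (hz : v z < 1) (hDz : D z = 1) : ρ.taylor D z = PowerSeries.X := by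
  ext n
  rw [taylor, PowerSeries.coeff_mk, PowerSeries.coeff_X]
  rcases n with _ | _ | n
  · simpa using (ρ.eq_zero_iff z hz.le).2 hz
  · simp [hDz, ρ.toFun_one]
  · have : D^[n] 0 = 0 := iterate_map_zero D n
    simp [Function.iterate_succ_apply, hDz, this, ρ.toFun_zero]

/-- The Taylor series as a ring homomorphism on the valuation ring. -/
def taylorHom [CharZero k] : v.valuationSubring →+* PowerSeries κ where
  toFun f := ρ.taylor D f
  map_one' := by simpa using ρ.taylor_algebraMap (D := D) 1
  map_zero' := by simpa using ρ.taylor_algebraMap (D := D) 0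
  map_add' f g := ρ.taylor_add hD f.2 g.2
  map_mul' f g := ρ.taylor_mul hD f.2 g.2

/-- If the derivation `d/dz` with respect to a uniformizer `z` preserves the valuation ring, the
Taylor series in `z` define an embedding of `K` into the field of Laurent series. -/
theorem exists_isExpansion [CharZero k] {z : K} (hz : v z = exp (-1)) (hDz : D z = 1) :
    ∃ φ : K →ₐ[k] LaurentSeries κ, φ z = HahnSeries.single 1 1 ∧ ρ.IsExpansion φ := by
  have hz1 : v z < 1 := by rw [hz, ← exp_zero]; exact exp_lt_exp.2 (by norm_num)
  let τ : v.valuationSubring →+* LaurentSeries κ :=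
    (HahnSeries.ofPowerSeries ℤ κ).comp (ρ.taylorHom hD)
  have hτ : ∀ (f : K) (hf : v f ≤ 1), τ ⟨f, hf⟩ = (ρ.taylor D f : LaurentSeries κ) :=
    fun _ _ => rfl
  have hunit : ∀ y : nonZeroDivisors v.valuationSubring, IsUnit (τ y) := by
    rintro ⟨⟨y, hy⟩, hy0⟩
    have hy0 : y ≠ 0 := fun h => nonZeroDivisors.ne_zero hy0 (Subtype.ext h)
    have hy : v y ≤ 1 := hy
    obtain ⟨n, hn⟩ : ∃ n : ℕ, v y = exp (-(n : ℤ)) := by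
      refine ⟨(-(v y).log).toNat, ?_⟩
      have hv := exp_log ((v.ne_zero_iff).2 hy0)
      have : (v y).log ≤ 0 := by rwa [log_le_iff_le_exp ((v.ne_zero_iff).2 hy0), exp_zero]
      rw [Int.toNat_of_nonneg (by omega), neg_neg, hv]
    obtain ⟨u, hu, rfl⟩ := v.eq_zpow_mul_of_le_exp hz hn.le
    have hu1 : v u = 1 := by
      rw [zpow_natCast, map_mul, map_pow, hz, ← exp_nsmul] at hn
      simpa using hn
    have hzn : v (z ^ n) ≤ 1 := by rw [map_pow]; exact pow_le_one' hz1.le n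
    have h1 : τ ⟨z ^ (n : ℤ) * u, hy⟩ = τ ⟨z, hz1.le⟩ ^ n * τ ⟨u, hu⟩ := by
      rw [← map_pow, ← map_mul]
      congr 1
      exact Subtype.ext (by simp)
    change IsUnit (τ ⟨z ^ (n : ℤ) * u, hy⟩)
    rw [h1]
    refine IsUnit.mul (IsUnit.pow n ?_) ?_
    · rw [hτ, ρ.taylor_eq_X hz1 hDz, PowerSeries.coe_X]
      exact IsUnit.of_mul_eq_one (HahnSeries.single (-1) 1) (by simp)
    · rw [hτ]
      refine IsUnit.map (HahnSeries.ofPowerSeries ℤ κ) ?_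
      rw [PowerSeries.isUnit_iff_constantCoeff, constantCoeff_taylor]
      exact ρ.isUnit_of_val_eq_one hu1
  let ψ : K →+* LaurentSeries κ := IsLocalization.lift hunit
  have hψ : ∀ (f : K) (_ : v f ≤ 1), ψ f = (ρ.taylor D f : LaurentSeries κ) := fun f hf =>
    IsLocalization.lift_eq hunit ⟨f, hf⟩
  refine ⟨{ ψ with
    commutes' := fun c => by
      change ψ _ = _
      rw [hψ _ (ρ.val_algebraMap c), taylor_algebraMap, HahnSeries.algebraMap_apply'] }, ?_, ?_⟩
  · change ψ z = _
    rw [hψ z hz1.le, ρ.taylor_eq_X hz1 hDz, PowerSeries.coe_X]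
  · exact fun f hf => ⟨ρ.taylor D f, hψ f hf, ρ.constantCoeff_taylor f⟩

end ResidueMap

end Taylor

/-! ### Places of a Dedekind domain over a point of the line -/

section Places

open WithZero IsDedekindDomain Module

variable {k A B : Type*} (K : Type*) [Field k] [CommRing A] [CommRing B] [IsDedekindDomain B]
  [Field K] [Algebra k A] [Algebra A B] [Algebra k B] [IsScalarTower k A B] [Algebra B K]
  [IsFractionRing B K] [Algebra k K] [IsScalarTower k B K]

namespace IsDedekindDomain.HeightOneSpectrum

variable (w : HeightOneSpectrum B)

/-- The residue at `w` of a function regular at `w`: the class modulo `w` of an element of the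
Dedekind domain that is close to the function. -/
def residueFun (f : K) : B ⧸ w.asIdeal :=
  open Classical in
  if h : ∃ b : B, w.valuation K (algebraMap B K b - f) < 1 then
    Ideal.Quotient.mk w.asIdeal h.choose else 0

variable {K w}

theorem residueFun_eq {f : K} {b : B} (h : w.valuation K (algebraMap B K b - f) < 1) :
    w.residueFun K f = Ideal.Quotient.mk w.asIdeal b := by
  have hex : ∃ b : B, w.valuation K (algebraMap B K b - f) < 1 := ⟨b, h⟩
  have hsub : algebraMap B K (hex.choose - b) =
      (algebraMap B K hex.choose - f) - (algebraMap B K b - f) := by rw [map_sub]; ring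
  rw [residueFun, dif_pos hex, Ideal.Quotient.eq, ← w.valuation_lt_one_iff_mem (K := K)]
  change w.valuation K (algebraMap B K _) < 1
  rw [hsub]
  exact (w.valuation K).map_sub_lt hex.choose_spec h

theorem residueFun_algebraMap (b : B) :
    w.residueFun K (algebraMap B K b) = Ideal.Quotient.mk w.asIdeal b :=
  residueFun_eq (by simp)

theorem exists_residueFun_eq {f : K} (hf : w.valuation K f ≤ 1) :
    ∃ b : B, w.valuation K (algebraMap B K b - f) < 1 := by
  simpa using w.exists_valuation_sub_lt_of_integer hf 1

variable (k K w)

/-- The residue map at `w`. -/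
def residueMap : ResidueMap k (w.valuation K) (B ⧸ w.asIdeal) where
  toFun := w.residueFun K
  toFun_add f g hf hg := by
    obtain ⟨a, ha⟩ := exists_residueFun_eq hf
    obtain ⟨b, hb⟩ := exists_residueFun_eq hg
    rw [residueFun_eq ha, residueFun_eq hb, ← map_add]
    refine residueFun_eq ?_
    rw [map_add, add_sub_add_comm]
    exact (w.valuation K).map_add_lt ha hb
  toFun_mul f g hf hg := by
    obtain ⟨a, ha⟩ := exists_residueFun_eq hf
    obtain ⟨b, hb⟩ := exists_residueFun_eq hg
    rw [residueFun_eq ha, residueFun_eq hb, ← map_mul]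
    refine residueFun_eq ?_
    have h : algebraMap B K (a * b) - f * g =
        algebraMap B K a * (algebraMap B K b - g) + (algebraMap B K a - f) * g := by
      rw [map_mul]; ring
    rw [h]
    refine (w.valuation K).map_add_lt ?_ ?_
    · rw [map_mul]
      exact (mul_le_of_le_one_left' (w.valuation_le_one a)).trans_lt hb
    · rw [map_mul]
      exact (mul_le_of_le_one_right' hg).trans_lt ha
  val_algebraMap c := by
    rw [IsScalarTower.algebraMap_apply k B K]
    exact w.valuation_le_one _
  toFun_algebraMap c := by
    rw [IsScalarTower.algebraMap_apply k B K, residueFun_algebraMap]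
    rfl
  eq_zero_iff f hf := by
    obtain ⟨a, ha⟩ := exists_residueFun_eq hf
    rw [residueFun_eq ha, Ideal.Quotient.eq_zero_iff_mem, ← w.valuation_lt_one_iff_mem (K := K)]
    constructor
    · intro h
      simpa using (w.valuation K).map_sub_lt h ha
    · intro h
      simpa using (w.valuation K).map_add_lt ha h

variable {k}

/-- The order of the coordinate `t` at a place over `t = 0` is the ramification index. -/
theorem valuation_eq_exp_ramificationIdx [IsDomain A] [Module.IsTorsionFree A B] {t : A}
    (ht : t ≠ 0) [w.asIdeal.LiesOver (Ideal.span {t})] :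
    w.valuation K (algebraMap B K (algebraMap A B t)) =
      exp (-(w.asIdeal.ramificationIdx A : ℤ)) := by
  have ht' : algebraMap A B t ≠ 0 := by
    rwa [Ne, FaithfulSMul.algebraMap_eq_zero_iff]
  have hmap : ∀ n : ℕ, (Ideal.span {t}).map (algebraMap A B) ≤ w.asIdeal ^ n ↔
      w.valuation K (algebraMap B K (algebraMap A B t)) ≤ exp (-(n : ℤ)) := fun n => by
    rw [Ideal.map_span, Set.image_singleton, Ideal.span_singleton_le_iff_mem,
      valuation_of_algebraMap, intValuation_le_pow_iff_mem]
  have hp : (Ideal.span {t} : Ideal A) ≠ ⊥ := by simpa using ht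
  rw [← Ideal.ramificationIdx'_eq_ramificationIdx (Ideal.span {t}) w.asIdeal hp]
  obtain ⟨n, hn⟩ : ∃ n : ℕ, w.valuation K (algebraMap B K (algebraMap A B t)) =
      exp (-(n : ℤ)) := by
    have hv : w.valuation K (algebraMap B K (algebraMap A B t)) ≠ 0 := by
      rw [Valuation.ne_zero_iff]
      simpa using ht'
    refine ⟨(-(w.valuation K (algebraMap B K (algebraMap A B t))).log).toNat, ?_⟩
    have h1 := w.valuation_le_one (K := K) (algebraMap A B t)
    rw [← exp_zero, ← log_le_iff_le_exp hv] at h1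
    rw [Int.toNat_of_nonneg (by omega), neg_neg, exp_log hv]
  rw [Ideal.ramificationIdx'_spec (n := n) ((hmap n).2 hn.le), hn]
  rw [hmap, hn, exp_le_exp]
  push_cast
  omega

end IsDedekindDomain.HeightOneSpectrum

omit [IsDedekindDomain B] in
/-- If `A = k + t A`, then the residue rings of `B` at ideals containing `t` are finite over `k`. -/
theorem Module.Finite.quotient_of_mem [Module.Finite A B] {t : A}
    (hA : ∀ a : A, ∃ (c : k) (a' : A), a = algebraMap k A c + t * a') (P : Ideal B)
    (hP : algebraMap A B t ∈ P) : Module.Finite k (B ⧸ P) := by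
  obtain ⟨S, hS⟩ := (inferInstance : Module.Finite A (B ⧸ P)).fg_top
  refine ⟨⟨S, ?_⟩⟩
  rw [eq_top_iff]
  rintro y -
  have hy : y ∈ Submodule.span A (S : Set (B ⧸ P)) := hS ▸ Submodule.mem_top
  induction hy using Submodule.span_induction with
  | mem y hy => exact Submodule.subset_span hy
  | zero => exact Submodule.zero_mem _
  | add y z _ _ hy hz => exact Submodule.add_mem _ hy hz
  | smul a y _ hy =>
    obtain ⟨c, a', rfl⟩ := hA a
    have h0 : algebraMap A (B ⧸ P) t = 0 := Ideal.Quotient.eq_zero_iff_mem.2 hP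
    have h1 : (algebraMap k A c + t * a') • y = c • y := by
      rw [add_smul, mul_smul, algebraMap_smul, Algebra.smul_def t, h0, zero_mul, add_zero]
    rw [h1]
    exact Submodule.smul_mem _ c hy

omit [IsDedekindDomain B] in
theorem Algebra.IsIntegral.quotient_of_mem [Module.Finite A B] {t : A}
    (hA : ∀ a : A, ∃ (c : k) (a' : A), a = algebraMap k A c + t * a') (P : Ideal B)
    (hP : algebraMap A B t ∈ P) : Algebra.IsIntegral k (B ⧸ P) :=
  have := Module.Finite.quotient_of_mem hA P hP
  inferInstance

omit [IsDedekindDomain B] in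
/-- The degree of a place over `t = 0` is its degree over `k`. -/
theorem Ideal.inertiaDeg_eq_finrank {t : A}
    (hA : ∀ a : A, ∃ (c : k) (a' : A), a = algebraMap k A c + t * a') (P : Ideal B)
    [P.IsMaximal] [(Ideal.span {t} : Ideal A).IsMaximal] [P.LiesOver (Ideal.span {t})] :
    P.inertiaDeg A = finrank k (B ⧸ P) := by
  rw [Ideal.inertiaDeg_eq_of_isMaximal (Ideal.span {t}) P]
  symm
  have hbij : Function.Bijective (algebraMap k (A ⧸ Ideal.span {t})) := by
    refine ⟨FaithfulSMul.algebraMap_injective _ _, fun y => ?_⟩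
    obtain ⟨a, rfl⟩ := Ideal.Quotient.mk_surjective y
    obtain ⟨c, a', rfl⟩ := hA a
    refine ⟨c, ?_⟩
    change Ideal.Quotient.mk _ (algebraMap k A c) = _
    rw [Ideal.Quotient.eq, sub_add_cancel_left, neg_mem_iff]
    exact Ideal.mul_mem_right _ _ (Ideal.mem_span_singleton_self t)
  refine Algebra.finrank_eq_of_equiv_equiv (RingEquiv.ofBijective _ hbij) (RingEquiv.refl _) ?_
  ext c
  change algebraMap (A ⧸ Ideal.span {t}) (B ⧸ P) (Ideal.Quotient.mk _ (algebraMap k A c)) =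
    Ideal.Quotient.mk P (algebraMap k B c)
  rw [Ideal.Quotient.algebraMap_mk_of_liesOver, ← IsScalarTower.algebraMap_apply k A B]

/-- A derivation of the function field of a `k`-algebra of finite type has bounded poles on the
functions regular at a place. -/
theorem IsDedekindDomain.HeightOneSpectrum.exists_val_derivation_le [Algebra.FiniteType k B]
    (w : HeightOneSpectrum B) (d : Derivation k K K) :
    ∃ M : ℤ, ∀ f : K, w.valuation K f ≤ 1 → w.valuation K (d f) ≤ exp M := by
  obtain ⟨S, hS⟩ := (inferInstance : Algebra.FiniteType k B).out
  obtain ⟨M, hM⟩ : ∃ M : ℤ, ∀ s ∈ S, w.valuation K (d (algebraMap B K s)) ≤ exp M := by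
    obtain ⟨M, hM⟩ := (S.image fun s => (w.valuation K (d (algebraMap B K s))).log).bddAbove
    exact ⟨M, fun s hs => le_exp_of_log_le (hM (Finset.mem_coe.2 (Finset.mem_image_of_mem _ hs)))⟩
  have hB : ∀ b : B, w.valuation K (d (algebraMap B K b)) ≤ exp M := by
    intro b
    have hb : b ∈ Algebra.adjoin k (S : Set B) := hS ▸ Algebra.mem_top
    induction hb using Algebra.adjoin_induction with
    | mem s hs => exact hM s hs
    | algebraMap c =>
      rw [← IsScalarTower.algebraMap_apply, d.map_algebraMap, map_zero]
      exact zero_le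
    | add a b _ _ ha hb =>
      rw [map_add, map_add]
      exact (w.valuation K).map_add_le ha hb
    | mul a b _ _ ha hb =>
      rw [map_mul, d.leibniz, smul_eq_mul, smul_eq_mul]
      refine (w.valuation K).map_add_le ?_ ?_
      · rw [map_mul]
        exact mul_le_of_le_one_of_le (w.valuation_le_one a) hb
      · rw [map_mul]
        exact mul_le_of_le_one_of_le (w.valuation_le_one b) ha
  refine ⟨M, fun f hf => ?_⟩
  obtain ⟨a, ⟨s, hs⟩, he⟩ := w.exists_primeCompl_mul_eq_of_integer f hf
  have hs1 : w.valuation K (algebraMap B K s) = 1 := by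
    rw [valuation_of_algebraMap]
    exact (w.intValuation_eq_one_iff_mem_primeCompl s).2 hs
  have h1 : d f * algebraMap B K s = d (algebraMap B K a) - f * d (algebraMap B K s) := by
    rw [← he, d.leibniz, smul_eq_mul, smul_eq_mul]; ring
  have h2 : w.valuation K (d f) = w.valuation K (d f * algebraMap B K s) := by
    rw [map_mul, hs1, mul_one]
  rw [h2, h1]
  refine (w.valuation K).map_sub_le (hB a) ?_
  rw [map_mul]
  exact mul_le_of_le_one_of_le hf (hB s)

end Places

/-! ### Differentials of a function field -/

section Differentials

open TensorProduct

variable (k K : Type*) [Field k] [CharZero k] [Field K] [Algebra k K] [Algebra (RatFunc k) K]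
  [IsScalarTower k (RatFunc k) K] [FiniteDimensional (RatFunc k) K]

/-- The derivation `d/dx` of a function field `K` over `k`: the module of differentials of `K` is
free on `dx`, because `K` is formally étale over `k[x]`. -/
theorem exists_derivation_of_functionField : ∃ d : Derivation k K K,
    d (algebraMap (RatFunc k) K RatFunc.X) = 1 ∧
    ∀ f, D k K f = d f • D k K (algebraMap (RatFunc k) K RatFunc.X) := by
  let : Algebra k[X] K := ((algebraMap (RatFunc k) K).comp (algebraMap k[X] (RatFunc k))).toAlgebra
  have : IsScalarTower k[X] (RatFunc k) K := IsScalarTower.of_algebraMap_eq' rfl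
  have : IsScalarTower k k[X] K := IsScalarTower.of_algebraMap_eq fun c => by
    rw [IsScalarTower.algebraMap_apply k[X] (RatFunc k) K, ← IsScalarTower.algebraMap_apply k k[X],
      ← IsScalarTower.algebraMap_apply]
  have : Algebra.FormallyEtale k[X] (RatFunc k) :=
    Algebra.FormallyEtale.of_isLocalization (nonZeroDivisors k[X])
  have : Algebra.FormallyEtale (RatFunc k) K := Algebra.FormallyEtale.of_isSeparable _ _
  have : Algebra.FormallyEtale k[X] K := Algebra.FormallyEtale.comp k[X] (RatFunc k) K
  let e : Ω[K⁄k] ≃ₗ[K] K := (tensorKaehlerEquivOfFormallyEtale k k[X] K).symm ≪≫ₗ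
    (polynomialEquiv k).baseChange k[X] K _ _ ≪≫ₗ AlgebraTensorModule.rid k[X] K K
  have hX : algebraMap (RatFunc k) K RatFunc.X = algebraMap k[X] K X := by
    rw [IsScalarTower.algebraMap_apply k[X] (RatFunc k) K, RatFunc.algebraMap_X]
  have he : e (D k K (algebraMap (RatFunc k) K RatFunc.X)) = 1 := by
    rw [hX]
    simp only [e, LinearEquiv.trans_apply, tensorKaehlerEquivOfFormallyEtale_symm_D_algebraMap]
    simp
  refine ⟨e.toLinearMap.compDer (D k K), he, fun f => e.injective ?_⟩
  rw [map_smul, he, smul_eq_mul, mul_one]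
  rfl

end Differentials

/-! ### The functions regular away from `x = 0` -/

section Infty

open WithZero IsDedekindDomain Module

variable {k K : Type*} [Field k] [Field K] [Algebra k K] [Algebra (RatFunc k) K]
  [IsScalarTower k (RatFunc k) K] {x : K}

theorem algebraMap_eq_aeval (hx : x = algebraMap (RatFunc k) K RatFunc.X) (p : k[X]) :
    algebraMap (RatFunc k) K (algebraMap k[X] (RatFunc k) p) = aeval x p := by
  rw [hx, aeval_algebraMap_apply]
  congr 1
  rw [← RatFunc.algebraMap_X, aeval_algebraMap_apply, aeval_X_left_apply]

theorem transcendental_coord (hx : x = algebraMap (RatFunc k) K RatFunc.X) :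
    Transcendental k x := by
  rw [transcendental_iff_injective, injective_iff_map_eq_zero]
  intro p hp
  rw [← algebraMap_eq_aeval hx, FaithfulSMul.algebraMap_eq_zero_iff] at hp
  exact (map_eq_zero_iff _ (IsFractionRing.injective k[X] (RatFunc k))).1 hp

theorem transcendental_inv_coord (hx : x = algebraMap (RatFunc k) K RatFunc.X) :
    Transcendental k x⁻¹ := fun h =>
  transcendental_coord hx (by simpa using h.inv)

omit [Algebra k K] [IsScalarTower k (RatFunc k) K] in
theorem coord_ne_zero (hx : x = algebraMap (RatFunc k) K RatFunc.X) : x ≠ 0 := by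
  rw [hx, Ne, FaithfulSMul.algebraMap_eq_zero_iff]
  exact RatFunc.X_ne_zero

omit [Algebra (RatFunc k) K] [IsScalarTower k (RatFunc k) K] in
theorem CoordInfty.exists_eq_aeval (a : CoordInfty k x) :
    ∃ p : k[X], a = aeval (invCoord k x) p := by
  obtain ⟨p, hp⟩ := Algebra.adjoin_mem_exists_aeval k x⁻¹ a.2
  refine ⟨p, Subtype.ext ?_⟩
  rw [← hp]
  exact (aeval_algHom_apply (CoordInfty k x).val (invCoord k x) p)

omit [Algebra (RatFunc k) K] [IsScalarTower k (RatFunc k) K] in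
theorem CoordInfty.exists_eq_add (a : CoordInfty k x) :
    ∃ (c : k) (a' : CoordInfty k x), a = algebraMap k _ c + invCoord k x * a' := by
  obtain ⟨p, rfl⟩ := CoordInfty.exists_eq_aeval a
  refine ⟨p.coeff 0, aeval (invCoord k x) p.divX, ?_⟩
  conv_lhs => rw [← p.X_mul_divX_add]
  rw [map_add, map_mul, aeval_X, aeval_C, add_comm]

omit [IsScalarTower k (RatFunc k) K] in
theorem invCoord_ne_zero (hx : x = algebraMap (RatFunc k) K RatFunc.X) : invCoord k x ≠ 0 :=
  fun h => inv_ne_zero (coord_ne_zero hx) (congrArg Subtype.val h)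

theorem invCoord_not_isUnit (hx : x = algebraMap (RatFunc k) K RatFunc.X) :
    ¬ IsUnit (invCoord k x) := by
  rw [isUnit_iff_exists_inv]
  rintro ⟨a, ha⟩
  obtain ⟨p, rfl⟩ := CoordInfty.exists_eq_aeval a
  have h1 : aeval x⁻¹ (X * p - 1) = 0 := by
    have := congrArg (CoordInfty k x).val ha
    rw [map_mul, ← aeval_algHom_apply, map_one] at this
    rw [map_sub, map_mul, aeval_X, map_one, sub_eq_zero]
    exact this
  have h2 := (transcendental_iff.1 (transcendental_inv_coord hx)) _ h1
  simpa using congrArg (eval 0) h2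

theorem span_invCoord_isMaximal (hx : x = algebraMap (RatFunc k) K RatFunc.X) :
    (Ideal.span {invCoord k x}).IsMaximal := by
  rw [Ideal.isMaximal_iff]
  refine ⟨?_, fun J a hJ ha haJ => ?_⟩
  · rw [← Ideal.eq_top_iff_one, Ideal.span_singleton_eq_top]
    exact invCoord_not_isUnit hx
  · obtain ⟨c, a', rfl⟩ := CoordInfty.exists_eq_add a
    have ht : invCoord k x * a' ∈ Ideal.span {invCoord k x} :=
      Ideal.mul_mem_right _ _ (Ideal.mem_span_singleton_self _)
    have hc : c ≠ 0 := by
      rintro rfl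
      rw [map_zero, zero_add] at ha
      exact ha ht
    have h1 := J.mul_mem_left (algebraMap k _ c⁻¹) ((Ideal.add_mem_iff_left J (hJ ht)).1 haJ)
    rwa [← map_mul, inv_mul_cancel₀ hc, map_one] at h1

instance CoordInfty.isPrincipalIdealRing : IsPrincipalIdealRing (CoordInfty k x) :=
  IsPrincipalIdealRing.of_surjective (aeval (R := k) (invCoord k x)) fun a =>
    let ⟨p, hp⟩ := CoordInfty.exists_eq_aeval a
    ⟨p, hp.symm⟩

instance CoordInfty.finiteType : Algebra.FiniteType k (CoordInfty k x) :=
  Algebra.FiniteType.of_surjective (aeval (R := k) (invCoord k x)) fun a =>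
    let ⟨p, hp⟩ := CoordInfty.exists_eq_aeval a
    ⟨p, hp.symm⟩

open IntermediateField in
theorem finiteDimensional_adjoin_inv (hx : x = algebraMap (RatFunc k) K RatFunc.X)
    [FiniteDimensional (RatFunc k) K] : FiniteDimensional k⟮x⁻¹⟯ K := by
  have hxmem : x ∈ k⟮x⁻¹⟯ := by
    simpa using inv_mem (mem_adjoin_simple_self k x⁻¹)
  have hpoly : ∀ p : k[X], aeval x p ∈ k⟮x⁻¹⟯ := fun p => by
    have := (aeval (⟨x, hxmem⟩ : k⟮x⁻¹⟯) p).2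
    rwa [← IntermediateField.coe_val, ← aeval_algHom_apply] at this
  have hmem : ∀ r : RatFunc k, algebraMap (RatFunc k) K r ∈ k⟮x⁻¹⟯ := fun r => by
    induction r using RatFunc.induction_on with
    | f p q hq =>
      rw [map_div₀, algebraMap_eq_aeval hx, algebraMap_eq_aeval hx]
      exact div_mem (hpoly p) (hpoly q)
  let : Algebra (RatFunc k) k⟮x⁻¹⟯ := ((algebraMap (RatFunc k) K).codRestrict k⟮x⁻¹⟯ hmem).toAlgebra
  have : IsScalarTower (RatFunc k) k⟮x⁻¹⟯ K := IsScalarTower.of_algebraMap_eq fun r => rfl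
  exact Module.Finite.of_restrictScalars_finite (RatFunc k) k⟮x⁻¹⟯ K

open IntermediateField algebraAdjoinAdjoin in
theorem isDedekindDomain_integralInfty [CharZero k]
    (hx : x = algebraMap (RatFunc k) K RatFunc.X) [FiniteDimensional (RatFunc k) K] :
    IsDedekindDomain (IntegralInfty k x) := by
  have := finiteDimensional_adjoin_inv hx
  have : IsDedekindDomain (CoordInfty k x) := inferInstance
  exact integralClosure.isDedekindDomain (CoordInfty k x) k⟮x⁻¹⟯ K

open IntermediateField algebraAdjoinAdjoin in
theorem isFractionRing_integralInfty
    (hx : x = algebraMap (RatFunc k) K RatFunc.X) [FiniteDimensional (RatFunc k) K] :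
    IsFractionRing (IntegralInfty k x) K := by
  have := finiteDimensional_adjoin_inv hx
  exact integralClosure.isFractionRing_of_finite_extension k⟮x⁻¹⟯ K

end Infty

/-! ### Logarithmic differentials at a place -/

section LogDifferential

open WithZero

/-- `a` is the coefficient of `z⁻¹ dz` in an expansion of `ω` in a local coordinate `z`. -/
def ResidueMap.HasResidueAt {k K κ : Type*} [Field k] [Field K] [Algebra k K] [CommRing κ]
    [Algebra k κ] {v : Valuation K ℤᵐ⁰} (ρ : ResidueMap k v κ) (ω : Ω[K⁄k]) (a : κ) : Prop :=
  ∃ (z f : K) (φ : K →ₐ[k] LaurentSeries κ), φ z = HahnSeries.single 1 1 ∧ ρ.IsExpansion φ ∧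
    ω = f • D k K z ∧ (φ f).coeff (-1) = a

variable {k K κ : Type*} [Field k] [CharZero k] [Field K] [Algebra k K] [CommRing κ] [IsDomain κ]
  [Algebra k κ] [Algebra.IsIntegral k κ] {v : Valuation K ℤᵐ⁰} (ρ : ResidueMap k v κ)

/-- The derivation `t d/dt`, for `d t ≠ 0` (and zero otherwise). -/
def logDerivation (d : Derivation k K K) (t : K) : Derivation k K K := (t / d t) • d

omit [CharZero k] in
theorem logDerivation_mul {d : Derivation k K K} {t : K} (hdt : d t ≠ 0) (f : K) :
    logDerivation d t f * d t = t * d f := by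
  rw [logDerivation, Derivation.smul_apply, smul_eq_mul]
  field_simp

include ρ in
/-- If the poles of a derivation are bounded at a place with uniformizer `π`, then its multiple
`d/dπ` preserves the valuation ring. -/
theorem ResidueMap.exists_normalized_derivation (d : Derivation k K K) (h0 : d ≠ 0)
    (hM : ∃ M : ℤ, ∀ f, v f ≤ 1 → v (d f) ≤ exp M) {π : K} (hπ : v π = exp (-1)) :
    d π ≠ 0 ∧ ∀ f, v f ≤ 1 → v (((d π)⁻¹ • d) f) ≤ 1 := by
  have hle := fun {f : K} (hf : v f ≤ 1) => ρ.val_derivation_le d hπ h0 hM hf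
  have hdπ : d π ≠ 0 := by
    intro h
    rw [h, map_zero] at hle
    refine h0 (Derivation.ext fun f => ?_)
    rcases le_total (v f) 1 with hf | hf
    · simpa using hle hf
    · have h1 : v f⁻¹ ≤ 1 := by rw [map_inv₀]; exact inv_le_one_of_one_le₀ hf
      have h2 : d f⁻¹ = 0 := by simpa using hle h1
      simpa using (d.leibniz_inv f⁻¹).trans (by rw [h2, smul_zero])
  refine ⟨hdπ, fun f hf => ?_⟩
  have hv : v (d π) ≠ 0 := (v.ne_zero_iff).2 hdπ
  rw [Derivation.smul_apply, smul_eq_mul, map_mul, map_inv₀]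
  calc _ ≤ (v (d π))⁻¹ * v (d π) := by gcongr; exact hle hf
    _ = 1 := inv_mul_cancel₀ hv

include ρ in
/-- In contrast to `ResidueMap.val_logDerivation_sub_le`, no derivation that preserves the valuation
ring is given beforehand, but one whose poles are bounded. -/
theorem ResidueMap.val_logDerivation_sub_le' (d : Derivation k K K) (h0 : d ≠ 0)
    (hM : ∃ M : ℤ, ∀ f, v f ≤ 1 → v (d f) ≤ exp M) {π : K} (hπ : v π = exp (-1)) {t : K}
    (hdt : d t ≠ 0) {e : ℕ} (he : 0 < e) (ht : v t = exp (-(e : ℤ))) (i : ℤ) (f : K)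
    (hf : v f ≤ exp (-i)) :
    v (logDerivation d t f - ((i : k) / (e : k)) • f) ≤ exp (-i - 1) := by
  obtain ⟨hdπ, hD⟩ := ρ.exists_normalized_derivation d h0 hM hπ
  refine ρ.val_logDerivation_sub_le ((d π)⁻¹ • d) _ he hπ ?_ hD ht (fun f => ?_) hf
  · rw [Derivation.smul_apply, smul_eq_mul, inv_mul_cancel₀ hdπ]
  · rw [Derivation.smul_apply, Derivation.smul_apply, smul_eq_mul, smul_eq_mul]
    linear_combination (d π)⁻¹ * logDerivation_mul hdt f

/-- The residue of `(a + t dh / dt) dt / t` is `e a`, where `e` is the order of `t`. -/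
theorem ResidueMap.hasResidueAt_iff {d : Derivation k K K} {x : K} (hdx : d x = 1)
    (hd : ∀ f, D k K f = d f • D k K x)
    (hM : ∃ M : ℤ, ∀ f, v f ≤ 1 → v (d f) ≤ exp M) {π : K} (hπ : v π = exp (-1)) {t : K}
    (hdt : d t ≠ 0) {e : ℕ} (ht : v t = exp (-(e : ℤ))) {g a h : K} (ha : v a ≤ 1)
    (hg : g = a + logDerivation d t h) (c : κ) :
    ρ.HasResidueAt ((g * (d t / t)) • D k K x) c ↔ c = e * ρ.toFun a := by
  have h0 : d ≠ 0 := by rintro rfl; exact zero_ne_one hdx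
  have ht0 : t ≠ 0 := by rintro rfl; simp at ht; exact exp_ne_zero ht.symm
  have hinj : ∀ {b c : K}, b • D k K x = c • D k K x → b = c := fun {b c} hbc => by
    simpa [hdx] using congrArg d.liftKaehlerDifferential hbc
  have key : ∀ (z f : K) (φ : K →ₐ[k] LaurentSeries κ), φ z = HahnSeries.single 1 1 →
      ρ.IsExpansion φ → (g * (d t / t)) • D k K x = f • D k K z →
      (φ f).coeff (-1) = e * ρ.toFun a := by
    intro z f φ hz hφ hω
    rw [hd z, smul_smul] at hω
    have h1 := hinj hω
    refine hφ.coeff_eq hπ hz ht (logDerivation d t) (fun y => ?_) ha (h := h) ?_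
    · have h2 := congrArg φ (logDerivation_mul hdt y)
      rw [map_mul, map_mul] at h2
      rw [LaurentSeries.euler_map φ d x hd y, LaurentSeries.euler_map φ d x hd t]
      linear_combination - LaurentSeries.euler (φ x) * h2
    · rw [← hg]
      have h2 := logDerivation_mul hdt z
      apply mul_right_cancel₀ hdt
      have h3 : g * d t = f * d z * t := by rw [← h1]; field_simp
      rw [h3]
      linear_combination f * h2
  constructor
  · rintro ⟨z, f, φ, hz, hφ, hω, rfl⟩
    exact key z f φ hz hφ hω
  · rintro rfl
    obtain ⟨hdπ, hD⟩ := ρ.exists_normalized_derivation d h0 hM hπ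
    obtain ⟨φ, hz, hφ⟩ := ρ.exists_isExpansion hD hπ (by
      rw [Derivation.smul_apply, smul_eq_mul, inv_mul_cancel₀ hdπ])
    have hω : (g * (d t / t)) • D k K x = (g * (d t / t) / d π) • D k K π := by
      rw [hd π, smul_smul, div_mul_cancel₀ _ hdπ]
    exact ⟨π, _, φ, hz, hφ, hω, key _ _ φ hz hφ hω⟩

include ρ in
/-- Every differential is of the form `(a + t dh / dt) dt / t` with `a` regular. -/
theorem ResidueMap.exists_eq_add_logDerivation (d : Derivation k K K) (h0 : d ≠ 0)
    (hM : ∃ M : ℤ, ∀ f, v f ≤ 1 → v (d f) ≤ exp M) {π : K} (hπ : v π = exp (-1)) {t : K}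
    (hdt : d t ≠ 0) {e : ℕ} (he : 0 < e) (ht : v t = exp (-(e : ℤ))) (g : K) :
    ∃ a h : K, v a ≤ 1 ∧ g = a + logDerivation d t h := by
  obtain ⟨h, hh⟩ := ρ.exists_val_sub_le_one (logDerivation d t) he
    (ρ.val_logDerivation_sub_le' d h0 hM hπ hdt he ht) g
  exact ⟨_, h, hh, (sub_add_cancel _ _).symm⟩

end LogDifferential

/-! ### Rational functions at `x = ∞` -/

section RationalInfty

open WithZero

section RatFunc

variable {k : Type*} [Field k]

/-- A nonzero rational function is `x` to the power of its degree times a unit at infinity. -/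
theorem RatFunc.exists_eq_zpow_mul (w : RatFunc k) (hw : w ≠ 0) : ∃ P Q : k[X], P.coeff 0 ≠ 0 ∧
    Q.coeff 0 ≠ 0 ∧ w = RatFunc.X ^ w.intDegree *
      (aeval (RatFunc.X : RatFunc k)⁻¹ P / aeval (RatFunc.X : RatFunc k)⁻¹ Q) := by
  have key : ∀ p : k[X], algebraMap k[X] (RatFunc k) p =
      RatFunc.X ^ p.natDegree * aeval (RatFunc.X : RatFunc k)⁻¹ p.reverse := by
    intro p
    have h := eval₂_reverse_mul_pow (algebraMap k (RatFunc k))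
      (Units.mk0 (RatFunc.X : RatFunc k) RatFunc.X_ne_zero) p
    rw [invOf_units] at h
    rw [mul_comm, aeval_def, ← Units.val_mk0 (RatFunc.X_ne_zero (K := k)), ← Units.val_inv_eq_inv_val]
    rw [h, Units.val_mk0, ← aeval_def, ← RatFunc.algebraMap_X, aeval_algebraMap_apply,
      aeval_X_left_apply]
  have hden := w.denom_ne_zero
  have hnum := RatFunc.num_ne_zero hw
  refine ⟨w.num.reverse, w.denom.reverse, ?_, ?_, ?_⟩
  · rw [coeff_zero_reverse]; exact leadingCoeff_ne_zero.2 hnum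
  · rw [coeff_zero_reverse]; exact leadingCoeff_ne_zero.2 hden
  · conv_lhs => rw [← RatFunc.num_div_denom w]
    rw [key, key, RatFunc.intDegree, zpow_sub₀ RatFunc.X_ne_zero, zpow_natCast, zpow_natCast]
    field_simp

theorem RatFunc.intDegree_X_zpow (n : ℤ) : (RatFunc.X ^ n : RatFunc k).intDegree = n := by
  have h : ∀ m : ℕ, (RatFunc.X ^ m : RatFunc k).intDegree = m := fun m => by
    rw [← RatFunc.algebraMap_X, ← map_pow, RatFunc.intDegree_polynomial, natDegree_X_pow]
  cases n with
  | ofNat m => simpa using h m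
  | negSucc m => rw [zpow_negSucc, RatFunc.intDegree_inv, h, Int.negSucc_eq]; push_cast; rfl

theorem expandInfty_X : expandInfty k RatFunc.X = HahnSeries.single (-1) 1 := by
  rw [expandInfty, RatFunc.liftAlgHom_apply]
  simp

theorem expandInfty_X_inv : expandInfty k RatFunc.X⁻¹ = HahnSeries.single 1 1 := by
  rw [map_inv₀, expandInfty_X, inv_eq_iff_eq_inv, eq_comm]
  refine inv_eq_of_mul_eq_one_right ?_
  simp

theorem expandInfty_aeval_X_inv (P : k[X]) :
    expandInfty k (aeval (RatFunc.X : RatFunc k)⁻¹ P) =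
      ((P : PowerSeries k) : LaurentSeries k) := by
  rw [← aeval_algHom_apply, expandInfty_X_inv, ← PowerSeries.coe_X, ← Polynomial.coe_X]
  induction P using Polynomial.induction_on' with
  | add p q hp hq => rw [map_add, hp, hq, Polynomial.coe_add, PowerSeries.coe_add]
  | monomial n a =>
    rw [aeval_monomial, ← C_mul_X_pow_eq_monomial, Polynomial.coe_mul, Polynomial.coe_pow,
      Polynomial.coe_C, PowerSeries.coe_mul, PowerSeries.coe_pow, HahnSeries.algebraMap_apply',
      PowerSeries.algebraMap_apply, Algebra.algebraMap_self, RingHom.id_apply]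

theorem exists_expandInfty_eq (w : RatFunc k) (hw : w ≠ 0) : ∃ s : PowerSeries k,
    PowerSeries.constantCoeff s ≠ 0 ∧
      expandInfty k w = HahnSeries.single (-w.intDegree) 1 * (s : LaurentSeries k) := by
  obtain ⟨P, Q, hP, hQ, he⟩ := w.exists_eq_zpow_mul hw
  have hP' : PowerSeries.constantCoeff (P : PowerSeries k) ≠ 0 := by simpa using hP
  have hQ' : PowerSeries.constantCoeff (Q : PowerSeries k) ≠ 0 := by simpa using hQ
  refine ⟨(P : PowerSeries k) * (Q : PowerSeries k)⁻¹, ?_, ?_⟩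
  · rw [map_mul, PowerSeries.constantCoeff_inv]
    exact mul_ne_zero hP' (inv_ne_zero hQ')
  · have h1 : expandInfty k (RatFunc.X ^ w.intDegree) = HahnSeries.single (-w.intDegree) 1 := by
      rw [← inv_inv RatFunc.X, inv_zpow', map_zpow₀, expandInfty_X_inv]
      generalize -w.intDegree = n
      cases n with
      | ofNat n => simp [HahnSeries.single_pow]
      | negSucc n =>
        rw [zpow_negSucc]
        refine inv_eq_of_mul_eq_one_right ?_
        rw [HahnSeries.single_pow, HahnSeries.single_mul_single]
        simp [Int.negSucc_eq]
    have h2 : ((Q : PowerSeries k) : LaurentSeries k)⁻¹ = (((Q : PowerSeries k)⁻¹ : PowerSeries k) :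
        LaurentSeries k) := by
      refine inv_eq_of_mul_eq_one_right ?_
      rw [← PowerSeries.coe_mul, PowerSeries.mul_inv_cancel _ hQ', PowerSeries.coe_one]
    conv_lhs => rw [he]
    rw [map_mul, h1, map_div₀, expandInfty_aeval_X_inv, expandInfty_aeval_X_inv, div_eq_mul_inv, h2,
      PowerSeries.coe_mul]

theorem ordInfty_eq (w : RatFunc k) (hw : w ≠ 0) : ordInfty w = ((-w.intDegree : ℤ) : WithTop ℤ) := by
  obtain ⟨s, hs, he⟩ := exists_expandInfty_eq w hw
  rw [ordInfty, he]
  apply le_antisymm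
  · refine HahnSeries.orderTop_le_of_coeff_ne_zero ?_
    have := HahnSeries.coeff_single_mul_add (r := (1 : k)) (x := (s : LaurentSeries k)) (a := 0)
      (b := -w.intDegree)
    rw [zero_add] at this
    rw [this, one_mul, ← Nat.cast_zero, PowerSeries.coeff_coe]
    simpa using hs
  · refine HahnSeries.le_orderTop_iff_forall.2 fun n hn => ?_
    have hn' : n + w.intDegree < 0 := by
      have := WithTop.coe_lt_coe.1 hn
      omega
    have := HahnSeries.coeff_single_mul_add (r := (1 : k)) (x := (s : LaurentSeries k))
      (a := n + w.intDegree) (b := -w.intDegree)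
    rw [add_neg_cancel_right] at this
    rw [this, one_mul, PowerSeries.coeff_coe, if_pos hn']

/-- Regularity at `x = ∞`. -/
theorem zero_le_ordInfty_iff (w : RatFunc k) : 0 ≤ ordInfty w ↔ w.intDegree ≤ 0 := by
  by_cases hw : w = 0
  · simp [hw, ordInfty]
  · rw [ordInfty_eq w hw, ← WithTop.coe_zero, WithTop.coe_le_coe]
    omega

theorem valueAtInfty_sub (w w' : RatFunc k) :
    valueAtInfty (w - w') = valueAtInfty w - valueAtInfty w' := by
  simp [valueAtInfty]

theorem valueAtInfty_algebraMap (c : k) : valueAtInfty (algebraMap k (RatFunc k) c) = c := by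
  rw [valueAtInfty, AlgHom.commutes, HahnSeries.algebraMap_apply', PowerSeries.algebraMap_apply,
    HahnSeries.ofPowerSeries_C]
  simp

theorem valueAtInfty_ne_zero {w : RatFunc k} (hw : w ≠ 0) (h : w.intDegree = 0) :
    valueAtInfty w ≠ 0 := by
  obtain ⟨s, hs, he⟩ := exists_expandInfty_eq w hw
  rw [valueAtInfty, he, h, neg_zero]
  have : (HahnSeries.single (0 : ℤ) (1 : k)) = 1 := rfl
  rw [this, one_mul, ← Nat.cast_zero, PowerSeries.coeff_coe]
  simpa using hs

theorem intDegree_sub_valueAtInfty {w : RatFunc k} (hw : w.intDegree ≤ 0) :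
    w - algebraMap k _ (valueAtInfty w) = 0 ∨
      (w - algebraMap k (RatFunc k) (valueAtInfty w)).intDegree < 0 := by
  by_cases h : w - algebraMap k _ (valueAtInfty w) = 0
  · exact Or.inl h
  · refine Or.inr (lt_of_le_of_ne ?_ fun h0 => ?_)
    · rw [← zero_le_ordInfty_iff, ordInfty, map_sub]
      refine le_trans ?_ HahnSeries.min_orderTop_le_orderTop_sub
      rw [le_min_iff]
      refine ⟨(zero_le_ordInfty_iff w).2 hw, ?_⟩
      refine (zero_le_ordInfty_iff _).2 ?_
      rw [RatFunc.algebraMap_eq_C, RatFunc.intDegree_C]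
    · refine valueAtInfty_ne_zero h h0 ?_
      rw [valueAtInfty_sub, valueAtInfty_algebraMap, sub_self]

/-- As `dx = -t⁻² dt`, the residue matrix of `G dx` is the value at infinity of `-x G`. -/
theorem residueMatrixInfty_apply {d : ℕ} (G : Matrix (Fin d) (Fin d) (RatFunc k)) (i j : Fin d) :
    residueMatrixInfty G i j = valueAtInfty (-(RatFunc.X * G i j)) := by
  rw [residueMatrixInfty, Matrix.of_apply, valueAtInfty, map_neg, map_mul, expandInfty_X, neg_mul,
    HahnSeries.coeff_neg, HahnSeries.coeff_neg]
  congr 1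
  have h1 := HahnSeries.coeff_single_mul_add (r := (1 : k)) (x := expandInfty k (G i j)) (a := 1)
    (b := -2)
  have h2 := HahnSeries.coeff_single_mul_add (r := (1 : k)) (x := expandInfty k (G i j)) (a := 1)
    (b := -1)
  norm_num at h1 h2
  rw [h1, h2]

end RatFunc

variable {k K : Type*} [Field k] [Field K] [Algebra k K] [Algebra (RatFunc k) K]
  [IsScalarTower k (RatFunc k) K] {x : K} {v : Valuation K ℤᵐ⁰}

theorem val_algebraMap_ratFunc (hx : x = algebraMap (RatFunc k) K RatFunc.X)
    (hk : ∀ c : k, c ≠ 0 → v (algebraMap k K c) = 1) {e : ℕ} (he : 0 < e)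
    (hv : v x⁻¹ = exp (-(e : ℤ))) (w : RatFunc k) (hw : w ≠ 0) :
    v (algebraMap (RatFunc k) K w) = exp (e * w.intDegree) := by
  obtain ⟨P, Q, hP, hQ, hPQ⟩ := w.exists_eq_zpow_mul hw
  have hlt : v x⁻¹ < 1 := by
    rw [hv, ← exp_zero, exp_lt_exp]; omega
  have hle : ∀ p : k[X], v (aeval x⁻¹ p) ≤ 1 := by
    intro p
    induction p using Polynomial.induction_on' with
    | add p q hp hq => rw [map_add]; exact v.map_add_le hp hq
    | monomial n a =>
      rw [aeval_monomial, map_mul, map_pow]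
      refine mul_le_one' ?_ (pow_le_one' hlt.le n)
      by_cases ha : a = 0
      · simp [ha]
      · exact (hk a ha).le
  have hone : ∀ p : k[X], p.coeff 0 ≠ 0 → v (aeval x⁻¹ p) = 1 := by
    intro p hp
    rw [← p.X_mul_divX_add, map_add, map_mul, aeval_X, aeval_C, ← hk _ hp]
    refine v.map_add_eq_of_lt_right ?_
    rw [hk _ hp, map_mul]
    exact (mul_le_of_le_one_right' (hle _)).trans_lt hlt
  have hmap : ∀ p : k[X], algebraMap (RatFunc k) K (aeval RatFunc.X⁻¹ p) = aeval x⁻¹ p := by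
    intro p
    rw [hx, ← map_inv₀, aeval_algebraMap_apply]
  have hvx : v x = exp (e : ℤ) := by
    rw [map_inv₀, exp_neg] at hv
    exact inv_injective hv
  conv_lhs => rw [hPQ]
  rw [map_mul, map_zpow₀, map_div₀, hmap, hmap, ← hx, map_mul, map_div₀, hone P hP, hone Q hQ,
    div_one, mul_one, map_zpow₀, hvx, ← exp_zsmul, smul_eq_mul, mul_comm]

theorem val_le_one_of_intDegree_le (hx : x = algebraMap (RatFunc k) K RatFunc.X)
    (hk : ∀ c : k, c ≠ 0 → v (algebraMap k K c) = 1) {e : ℕ} (he : 0 < e)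
    (hv : v x⁻¹ = exp (-(e : ℤ))) {w : RatFunc k} (h : w.intDegree ≤ 0) :
    v (algebraMap (RatFunc k) K w) ≤ 1 := by
  by_cases hw : w = 0
  · simp [hw]
  · rw [val_algebraMap_ratFunc hx hk he hv w hw, ← exp_zero, exp_le_exp]
    exact mul_nonpos_of_nonneg_of_nonpos (by positivity) h

/-- A rational function regular at infinity agrees with its value there up to order `e`. -/
theorem val_sub_valueAtInfty_le (hx : x = algebraMap (RatFunc k) K RatFunc.X)
    (hk : ∀ c : k, c ≠ 0 → v (algebraMap k K c) = 1) {e : ℕ} (he : 0 < e)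
    (hv : v x⁻¹ = exp (-(e : ℤ))) {w : RatFunc k} (h : w.intDegree ≤ 0) :
    v (algebraMap (RatFunc k) K w - algebraMap k K (valueAtInfty w)) ≤ exp (-(e : ℤ)) := by
  rw [IsScalarTower.algebraMap_apply k (RatFunc k) K, ← map_sub]
  rcases intDegree_sub_valueAtInfty h with h | h
  · rw [h, map_zero, map_zero]
    exact zero_le
  · have hne : w - algebraMap k (RatFunc k) (valueAtInfty w) ≠ 0 := by
      intro h0
      rw [h0, RatFunc.intDegree_zero] at h
      exact lt_irrefl _ h
    rw [val_algebraMap_ratFunc hx hk he hv _ hne, exp_le_exp]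
    nlinarith

end RationalInfty

/-! ### The residue matrix and orders of vanishing at the points at infinity -/

section Exponents

open WithZero

/-- The functions of order at least `-n`. -/
def ResidueMap.leSubmodule {k K κ : Type*} [Field k] [Field K] [Algebra k K] [CommRing κ]
    [Algebra k κ] {v : Valuation K ℤᵐ⁰} (ρ : ResidueMap k v κ) (n : ℤ) : Submodule k K where
  carrier := {f | v f ≤ exp n}
  add_mem' hf hg := v.map_add_le hf hg
  zero_mem' := by simp
  smul_mem' c _ hf := ρ.val_smul_le c hf

/-- The leading coefficient at order `i`, with respect to the uniformizer `π`. -/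
theorem ResidueMap.exists_leadingCoeff {k K κ : Type*} [Field k] [Field K] [Algebra k K]
    [CommRing κ] [Algebra k κ] {v : Valuation K ℤᵐ⁰} (ρ : ResidueMap k v κ) {π : K}
    (hπ : v π = exp (-1)) (i : ℕ) :
    ∃ s : K →ₗ[k] κ, ∀ f, v f ≤ exp (-(i : ℤ)) → s f = 0 → v f ≤ exp (-((i + 1 : ℕ) : ℤ)) := by
  have hle : ∀ f, v f ≤ exp (-(i : ℤ)) → v (f * (π ^ i)⁻¹) ≤ 1 := fun f hf => by
    rw [map_mul, map_inv₀, map_pow, hπ, ← exp_nsmul, ← exp_neg]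
    calc _ ≤ exp (-(i : ℤ)) * exp (-(i • (-1 : ℤ))) := by gcongr
      _ = 1 := by rw [← exp_add]; simp
  let s₀ : ρ.leSubmodule (-(i : ℤ)) →ₗ[k] κ :=
    { toFun f := ρ.toFun (f.1 * (π ^ i)⁻¹)
      map_add' f g := by
        rw [Submodule.coe_add, add_mul]
        exact ρ.toFun_add _ _ (hle _ f.2) (hle _ g.2)
      map_smul' c f := by
        rw [Submodule.coe_smul, smul_mul_assoc]
        exact ρ.toFun_smul c (hle _ f.2) }
  obtain ⟨s, hs⟩ := s₀.exists_extend
  refine ⟨s, fun f hf h => ?_⟩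
  have h1 : ρ.toFun (f * (π ^ i)⁻¹) = 0 := by
    rw [← h]
    exact (LinearMap.congr_fun hs ⟨f, hf⟩).symm
  rw [ρ.eq_zero_iff _ (hle f hf), map_mul, map_inv₀, map_pow, hπ, ← exp_nsmul, ← exp_neg,
    ← lt_mul_inv_iff₀ (by simp), ← exp_neg, one_mul, lt_exp_iff_le_exp_sub_one] at h1
  refine h1.trans_eq ?_
  congr 1
  simp
  ring

theorem valueAtInfty_sum_smul {k : Type*} [Field k] {ι : Type*} (s : Finset ι) (c : ι → k)
    (w : ι → RatFunc k) :
    valueAtInfty (∑ j ∈ s, c j • w j) = ∑ j ∈ s, c j * valueAtInfty (w j) := by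
  simp only [valueAtInfty, map_sum, HahnSeries.coeff_sum]
  refine Finset.sum_congr rfl fun j _ => ?_
  rw [Algebra.smul_def, map_mul, AlgHom.commutes, HahnSeries.algebraMap_apply', PowerSeries.algebraMap_apply,
    HahnSeries.ofPowerSeries_C, HahnSeries.C_mul_eq_smul, HahnSeries.coeff_smul]
  rfl

variable {k K : Type*} [Field k] [Field K] [Algebra k K] [Algebra (RatFunc k) K]
  [IsScalarTower k (RatFunc k) K] {x : K} {ι : Type*} {v : ι → Valuation K ℤᵐ⁰}
  {κ : ι → Type*} [∀ P, CommRing (κ P)] [∀ P, Algebra k (κ P)]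
  (ρ : ∀ P, ResidueMap k (v P) (κ P)) (hx : x = algebraMap (RatFunc k) K RatFunc.X)
  {e : ι → ℕ} (he : ∀ P, 0 < e P) (hv : ∀ P, v P x⁻¹ = exp (-(e P : ℤ)))
  {d : ℕ} {b : Fin d → K} (hb : ∀ P i, v P (b i) ≤ 1)

include ρ hx he hv hb

theorem val_sum_smul_sub_le {w : Fin d → RatFunc k} (hw : ∀ i, (w i).intDegree ≤ 0) (P : ι) :
    v P (∑ i, w i • b i - ∑ i, valueAtInfty (w i) • b i) ≤ exp (-(e P : ℤ)) := by
  rw [← Finset.sum_sub_distrib]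
  refine (v P).map_sum_le fun i _ => ?_
  rw [Algebra.smul_def, Algebra.smul_def, ← sub_mul, map_mul]
  calc _ ≤ exp (-(e P : ℤ)) * 1 := by
        gcongr
        · exact val_sub_valueAtInfty_le hx (fun c hc => (ρ P).val_algebraMap_of_ne_zero hc)
            (he P) (hv P) (hw i)
        · exact hb P i
    _ = _ := mul_one _

variable (hb0 : ∀ c : Fin d → k, (∀ P, v P (∑ i, c i • b i) ≤ exp (-(e P : ℤ))) → c = 0)

include hb0

/-- The coordinates of a function that is regular over `x = ∞` are regular at infinity: after
division by a power of `x` with too large an exponent, the values of the coordinates would be a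
nonzero combination of the basis vanishing modulo `1/x`. -/
theorem intDegree_nonpos_of_val_sum_smul_le {w : Fin d → RatFunc k}
    (h : ∀ P, v P (∑ i, w i • b i) ≤ 1) (i : Fin d) : (w i).intDegree ≤ 0 := by
  by_contra! hi
  obtain ⟨i₀, -, hmax⟩ := Finset.exists_max_image Finset.univ (fun i => (w i).intDegree)
    ⟨i, Finset.mem_univ i⟩
  set m := (w i₀).intDegree with hm
  have hm0 : 0 < m := hi.trans_le (hmax i (Finset.mem_univ i))
  have hdeg : ∀ i, w i ≠ 0 → (RatFunc.X ^ (-m) * w i).intDegree = (w i).intDegree - m := by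
    intro i hwi
    rw [RatFunc.intDegree_mul (zpow_ne_zero _ RatFunc.X_ne_zero) hwi,
      RatFunc.intDegree_X_zpow]
    ring
  have hle : ∀ i, (RatFunc.X ^ (-m) * w i).intDegree ≤ 0 := by
    intro i
    by_cases hwi : w i = 0
    · simp [hwi]
    · rw [hdeg i hwi]
      have := hmax i (Finset.mem_univ i)
      omega
  have hw₀ : w i₀ ≠ 0 := by
    intro h0
    rw [hm, h0, RatFunc.intDegree_zero] at hm0
    exact lt_irrefl _ hm0
  have hne := valueAtInfty_ne_zero
    (mul_ne_zero (zpow_ne_zero (-m) RatFunc.X_ne_zero) hw₀) (by rw [hdeg i₀ hw₀, sub_self])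
  refine hne (congrFun (hb0 (fun i => valueAtInfty (RatFunc.X ^ (-m) * w i)) fun P => ?_) i₀)
  have h1 := val_sum_smul_sub_le ρ hx he hv hb hle P
  have h2 : v P (∑ i, (RatFunc.X ^ (-m) * w i) • b i) ≤ exp (-(e P : ℤ)) := by
    have : ∑ i, (RatFunc.X ^ (-m) * w i) • b i = x⁻¹ ^ m * ∑ i, w i • b i := by
      rw [Finset.mul_sum]
      refine Finset.sum_congr rfl fun i _ => ?_
      rw [mul_smul, Algebra.smul_def, map_zpow₀, ← hx, inv_zpow', zpow_neg]
    rw [this, map_mul, map_zpow₀, hv, ← exp_zsmul]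
    calc _ ≤ exp (m • (-(e P : ℤ))) * 1 := by gcongr; exact h P
      _ ≤ _ := by
        rw [mul_one, exp_le_exp, smul_eq_mul]
        have := he P
        nlinarith
  simpa using (v P).map_sub_le h2 h1

/-- The orders of vanishing at the points over `x = ∞` are an exponent filtration for the residue
matrix of the logarithmic derivation: a function of order `i` at `P` is multiplied by `i / e P` up
to higher order terms. -/
theorem exists_exponentFiltration (hπ : ∀ P, ∃ π, v P π = exp (-1)) (Θ : Derivation k K K)
    (hΘ : ∀ P (i : ℤ) f, v P f ≤ exp (-i) →
      v P (Θ f - ((i : k) / (e P : k)) • f) ≤ exp (-i - 1))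
    {H : Matrix (Fin d) (Fin d) (RatFunc k)} (hH : ∀ j, Θ (b j) = ∑ i, H i j • b i) :
    ∃ E : ExponentFiltration (Matrix.toLin' (H.map valueAtInfty)) e κ,
      ∀ P i c, c ∈ E.F P i ↔ v P (∑ j, c j • b j) ≤ exp (-(i : ℤ)) := by
  choose π hπ using hπ
  choose s hs using fun (P : ι) (i : ℕ) => (ρ P).exists_leadingCoeff (hπ P) i
  have hreg : ∀ P (c : Fin d → k), v P (∑ i, c i • b i) ≤ 1 := fun P c =>
    (v P).map_sum_le fun i _ => (ρ P).val_smul_le _ (hb P i)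
  have hlin : ∀ c : Fin d → k, Fintype.linearCombination k b c = ∑ i, c i • b i := fun c =>
    Fintype.linearCombination_apply k b c
  refine ⟨{ F P i := ((ρ P).leSubmodule (-(i : ℤ))).comap (Fintype.linearCombination k b)
            F_zero P := ?_
            sub_mem P i hi c hc := ?_
            eq_zero c hc := hb0 c fun P => by rw [← hlin]; exact hc P
            symb P i := s P i ∘ₗ Fintype.linearCombination k b
            mem_succ P i hi c hc h0 := hs P i _ hc h0 }, fun P i c => by rw [← hlin]; rfl⟩
  · rw [eq_top_iff]
    intro c _
    change v P (Fintype.linearCombination k b c) ≤ _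
    rw [hlin]
    simpa using hreg P c
  · change v P (Fintype.linearCombination k b _) ≤ _
    replace hc : v P (Fintype.linearCombination k b c) ≤ exp (-(i : ℤ)) := hc
    set f := Fintype.linearCombination k b c with hf
    set w : Fin d → RatFunc k := fun i => ∑ j, c j • H i j with hw
    have hval : Matrix.toLin' (H.map valueAtInfty) c = fun i => valueAtInfty (w i) := by
      funext i
      rw [hw, valueAtInfty_sum_smul, Matrix.toLin'_apply]
      simp only [Matrix.mulVec, dotProduct, Matrix.map_apply]
      exact Finset.sum_congr rfl fun j _ => mul_comm _ _
    have hΘf : Θ f = ∑ i, w i • b i := by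
      rw [hf, hlin, map_sum]
      have : ∀ j, Θ (c j • b j) = ∑ i, (c j • H i j) • b i := fun j => by
        rw [Θ.map_smul, hH, Finset.smul_sum]
        exact Finset.sum_congr rfl fun i _ => (smul_assoc _ _ _).symm
      simp only [this, hw, Finset.sum_smul]
      exact Finset.sum_comm
    have hΘ0 : ∀ P, v P (∑ i, w i • b i) ≤ 1 := by
      intro P
      have := hΘ P 0 f (by rw [hf, hlin]; simpa using hreg P c)
      rw [← hΘf]
      refine (by simpa using this : v P (Θ f) ≤ exp (-1)).trans ?_
      rw [← exp_zero, exp_le_exp]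
      norm_num
    have h1 := val_sum_smul_sub_le ρ hx he hv hb
      (intDegree_nonpos_of_val_sum_smul_le ρ hx he hv hb hb0 hΘ0) P
    have h2 := hΘ P i f hc
    rw [hval, map_sub, map_smul, hlin, ← hf]
    have : ∑ i, valueAtInfty (w i) • b i - ((i : k) / (e P : k)) • f =
        (Θ f - (((i : ℤ) : k) / (e P : k)) • f) -
          (∑ i, w i • b i - ∑ i, valueAtInfty (w i) • b i) := by
      rw [hΘf, Int.cast_natCast]; abel
    rw [this]
    refine (v P).map_sub_le (h2.trans ?_) (h1.trans ?_) <;> rw [exp_le_exp] <;> push_cast <;> omega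

end Exponents

/-! ### The points over `x = ∞` as places of the function field -/

section Points

open WithZero IsDedekindDomain

section Dedekind

variable {k A B K : Type*} [Field k] [CommRing A] [CommRing B] [IsDedekindDomain B]
  [Field K] [Algebra k A] [Algebra A B] [Algebra k B] [IsScalarTower k A B] [Algebra B K]
  [IsFractionRing B K] [Algebra k K] [IsScalarTower k B K]

omit [Algebra k A] [IsScalarTower k A B] [Algebra k B] [Algebra k K] [IsScalarTower k B K] in
/-- An element of the Dedekind domain vanishing modulo `t` at all places over `t = 0` is a multiple
of `t`. -/
theorem exists_smul_eq_of_valuation_le {t : A} (ht : algebraMap A B t ≠ 0) {f : B}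
    (hf : ∀ w : HeightOneSpectrum B, algebraMap A B t ∈ w.asIdeal →
      w.valuation K (algebraMap B K f) ≤ w.valuation K (algebraMap B K (algebraMap A B t))) :
    ∃ g : B, f = t • g := by
  have ht' : algebraMap B K (algebraMap A B t) ≠ 0 := by
    rwa [Ne, FaithfulSMul.algebraMap_eq_zero_iff]
  obtain ⟨g, hg⟩ := HeightOneSpectrum.mem_integers_of_valuation_le_one (R := B) (K := K)
    (algebraMap B K f / algebraMap B K (algebraMap A B t)) fun w => by
      rw [map_div₀]
      refine div_le_one_of_le₀ ?_ zero_le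
      by_cases hw : algebraMap A B t ∈ w.asIdeal
      · exact hf w hw
      · have : w.valuation K (algebraMap B K (algebraMap A B t)) = 1 := by
          rw [HeightOneSpectrum.valuation_of_algebraMap]
          exact (w.intValuation_eq_one_iff_mem_primeCompl _).2 hw
        rw [this]
        exact w.valuation_le_one f
  refine ⟨g, IsFractionRing.injective B K ?_⟩
  rw [Algebra.smul_def, map_mul, hg]
  field_simp

/-- A `k`-linear combination of an `A`-basis does not vanish modulo `t`. -/
theorem Module.Basis.eq_zero_of_valuation_sum_smul_le [IsDomain A] [Module.IsTorsionFree A B]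
    {t : A} (ht : t ≠ 0) (ht' : ¬ IsUnit t) {d : ℕ} (b : Module.Basis (Fin d) A B)
    (c : Fin d → k)
    (hc : ∀ w : HeightOneSpectrum B, algebraMap A B t ∈ w.asIdeal →
      w.valuation K (∑ i, c i • algebraMap B K (b i)) ≤
        w.valuation K (algebraMap B K (algebraMap A B t))) : c = 0 := by
  have hsum : ∑ i, c i • algebraMap B K (b i) =
      algebraMap B K (∑ i, algebraMap k A (c i) • b i) := by
    rw [map_sum]
    refine Finset.sum_congr rfl fun i _ => ?_
    rw [Algebra.smul_def (algebraMap k A (c i)), map_mul, ← IsScalarTower.algebraMap_apply k A B,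
      ← IsScalarTower.algebraMap_apply k B K, Algebra.smul_def]
  obtain ⟨g, hg⟩ := exists_smul_eq_of_valuation_le (K := K) (t := t)
    (by rwa [Ne, FaithfulSMul.algebraMap_eq_zero_iff])
    (f := ∑ i, algebraMap k A (c i) • b i) fun w hw => hsum ▸ hc w hw
  funext i
  by_contra hi
  have h1 := congrArg (fun f => b.repr f i) hg
  simp only [b.repr_sum_self, map_smul, Finsupp.smul_apply, smul_eq_mul] at h1
  exact ht' (isUnit_of_mul_isUnit_left
    (h1 ▸ (IsUnit.mk0 (c i) hi).map (algebraMap k A)))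

/-- An expansion of the functions in the Dedekind domain extends to the valuation ring. -/
theorem IsDedekindDomain.HeightOneSpectrum.isExpansion_iff (w : HeightOneSpectrum B)
    (φ : K →ₐ[k] LaurentSeries (B ⧸ w.asIdeal)) :
    (w.residueMap k K).IsExpansion φ ↔ ∀ b : B, ∃ s : PowerSeries (B ⧸ w.asIdeal),
      φ (algebraMap B K b) = (s : LaurentSeries (B ⧸ w.asIdeal)) ∧
        PowerSeries.constantCoeff s = Ideal.Quotient.mk w.asIdeal b := by
  constructor
  · intro h b
    obtain ⟨s, h1, h2⟩ := h _ (w.valuation_le_one b)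
    exact ⟨s, h1, h2.trans (w.residueFun_algebraMap b)⟩
  · intro h f hf
    obtain ⟨a, ⟨c, hc⟩, he⟩ := w.exists_primeCompl_mul_eq_of_integer f hf
    have hc1 : w.valuation K (algebraMap B K c) = 1 := by
      rw [valuation_of_algebraMap]
      exact (w.intValuation_eq_one_iff_mem_primeCompl c).2 hc
    have hu := (w.residueMap k K).isUnit_of_val_eq_one hc1
    obtain ⟨s, hs1, hs2⟩ := h a
    obtain ⟨s', hs1', hs2'⟩ := h c
    have hres : ∀ b : B, (w.residueMap k K).toFun (algebraMap B K b) =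
      Ideal.Quotient.mk w.asIdeal b := w.residueFun_algebraMap
    rw [hres, ← hs2'] at hu
    obtain ⟨s'', hs''⟩ := (PowerSeries.isUnit_iff_constantCoeff.2 hu).exists_right_inv
    refine ⟨s * s'', ?_, ?_⟩
    · rw [PowerSeries.coe_mul, ← hs1, ← he, map_mul, hs1', mul_assoc, ← PowerSeries.coe_mul, hs'',
        PowerSeries.coe_one, mul_one]
    · have h1 := (w.residueMap k K).toFun_mul f (algebraMap B K c) hf hc1.le
      rw [he, hres, hres, ← hs2, ← hs2'] at h1
      rw [map_mul, h1, mul_assoc, ← map_mul, hs'', map_one, mul_one]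

end Dedekind

variable {k K : Type*} [Field k] [Field K] [Algebra k K] {x : K}

namespace IsIntegralBasisInfty

variable {d : ℕ} {b : Fin d → K} (hb : IsIntegralBasisInfty k x b)

include hb in
theorem mem (i : Fin d) : b i ∈ IntegralInfty k x := by
  have : b i ∈ Submodule.span (CoordInfty k x) (Set.range b) :=
    Submodule.subset_span (Set.mem_range_self i)
  rw [hb.2] at this
  exact this

/-- An integral basis as a basis of the integral closure. -/
def basis : Module.Basis (Fin d) (CoordInfty k x) (IntegralInfty k x) :=
  Module.Basis.mk (v := fun i => (⟨b i, hb.mem i⟩ : IntegralInfty k x))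
    (LinearIndependent.of_comp (IntegralInfty k x).val.toLinearMap hb.1) (by
      rintro ⟨f, hf⟩ -
      rw [← Subalgebra.mem_toSubmodule, ← hb.2] at hf
      have hrange : Set.range b = (IntegralInfty k x).val.toLinearMap ''
          Set.range fun i => (⟨b i, hb.mem i⟩ : IntegralInfty k x) := by
        rw [← Set.range_comp]
        rfl
      rw [hrange, ← Submodule.map_span] at hf
      obtain ⟨y, hy, rfl⟩ := hf
      exact hy)

theorem basis_apply (i : Fin d) : (hb.basis i : K) = b i := by
  rw [basis, Module.Basis.mk_apply]

end IsIntegralBasisInfty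

namespace PointInfty

variable (P : PointInfty k x)

/-- A point over `x = ∞` as a place of the Dedekind domain of functions regular away from
`x = 0`. -/
def place (ht : invCoord k x ≠ 0) : HeightOneSpectrum (IntegralInfty k x) where
  asIdeal := P.ideal
  isPrime := P.isMaximal.isPrime
  ne_bot h := by
    have := P.inv_mem
    rw [h, Ideal.mem_bot] at this
    have h0 := congrArg Subtype.val this
    exact ht (Subtype.ext h0)

instance : P.ideal.IsMaximal := P.isMaximal

theorem liesOver (h : (Ideal.span {invCoord k x}).IsMaximal) :
    P.ideal.LiesOver (Ideal.span {invCoord k x}) := by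
  refine ⟨h.eq_of_le (Ideal.comap_ne_top _ P.isMaximal.ne_top) ?_⟩
  rw [Ideal.span_singleton_le_iff_mem]
  exact P.inv_mem

/-- The points over `x = ∞` are the primes over the maximal ideal generated by `1/x`. -/
def equivPrimesOver (h : (Ideal.span {invCoord k x}).IsMaximal) :
    PointInfty k x ≃ (Ideal.span {invCoord k x}).primesOver (IntegralInfty k x) where
  toFun P := ⟨P.ideal, P.isMaximal.isPrime, P.liesOver h⟩
  invFun Q :=
    { ideal := Q.1
      isMaximal := by
        have := Q.2.1
        have := Q.2.2
        exact Ideal.IsMaximal.of_liesOver_isMaximal Q.1 (Ideal.span {invCoord k x})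
      inv_mem := by
        have := Q.2.2
        have h' := Ideal.mem_of_liesOver Q.1 (Ideal.span {invCoord k x}) (invCoord k x)
        exact h'.1 (Ideal.mem_span_singleton_self _) }
  left_inv _ := rfl
  right_inv _ := rfl

end PointInfty

end Points

section PlacesInfty

open WithZero IsDedekindDomain

theorem LaurentSeries.algebraMap_eq_C {k κ : Type*} [Field k] [CommRing κ] [Algebra k κ] (c : k) :
    algebraMap k (LaurentSeries κ) c = HahnSeries.C (algebraMap k κ c) := by
  rw [HahnSeries.algebraMap_apply', PowerSeries.algebraMap_apply, HahnSeries.ofPowerSeries_C]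

/-- An expansion is a ring homomorphism that is determined by its values on the Dedekind domain and
compatible with the coefficient embeddings of `k`. The latter form of the condition does not depend
on how Laurent series are made into a `k`-algebra. -/
theorem IsDedekindDomain.HeightOneSpectrum.hasResidueAt_iff_exists {k B K : Type*} [Field k]
    [CommRing B] [IsDedekindDomain B] [Field K] [Algebra k B] [Algebra B K]
    [IsFractionRing B K] [Algebra k K] [IsScalarTower k B K] (w : HeightOneSpectrum B)
    (ω : Ω[K⁄k]) (a : B ⧸ w.asIdeal) :
    (w.residueMap k K).HasResidueAt ω a ↔
      ∃ (z f : K) (φ : K →+* LaurentSeries (B ⧸ w.asIdeal)),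
        (∀ c : k, φ (algebraMap k K c) = HahnSeries.C (algebraMap k (B ⧸ w.asIdeal) c)) ∧
        φ z = HahnSeries.single 1 1 ∧
        (∀ b : B, ∃ s : PowerSeries (B ⧸ w.asIdeal),
          φ (algebraMap B K b) = (s : LaurentSeries (B ⧸ w.asIdeal)) ∧
          PowerSeries.constantCoeff s = Ideal.Quotient.mk w.asIdeal b) ∧
        ω = f • D k K z ∧ (φ f).coeff (-1) = a := by
  constructor
  · rintro ⟨z, f, φ, hz, hφ, hω, ha⟩
    exact ⟨z, f, φ.toRingHom, fun c => (φ.commutes c).trans (LaurentSeries.algebraMap_eq_C c),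
      hz, (w.isExpansion_iff φ).1 hφ, hω, ha⟩
  · rintro ⟨z, f, φ, hc, hz, hφ, hω, ha⟩
    exact ⟨z, f, ⟨φ, fun c => (hc c).trans (LaurentSeries.algebraMap_eq_C c).symm⟩,
      hz, (w.isExpansion_iff _).2 hφ, hω, ha⟩

variable {k K : Type*} [Field k] [Field K] [Algebra k K] {x : K}

instance : IsScalarTower k (CoordInfty k x) (IntegralInfty k x) :=
  IsScalarTower.of_algebraMap_eq fun _ => rfl

instance : IsScalarTower k (IntegralInfty k x) K :=
  IsScalarTower.of_algebraMap_eq fun _ => rfl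

instance : Module.IsTorsionFree (CoordInfty k x) (IntegralInfty k x) := by
  have : FaithfulSMul (CoordInfty k x) (IntegralInfty k x) := by
    rw [faithfulSMul_iff_algebraMap_injective]
    intro a b h
    have h0 := congrArg Subtype.val h
    exact Subtype.ext h0
  infer_instance

theorem IsIntegralBasisInfty.finite {d : ℕ} {b : Fin d → K} (hb : IsIntegralBasisInfty k x b) :
    Module.Finite (CoordInfty k x) (IntegralInfty k x) :=
  Module.Finite.of_basis hb.basis

theorem IsIntegralBasisInfty.finiteType {d : ℕ} {b : Fin d → K}
    (hb : IsIntegralBasisInfty k x b) : Algebra.FiniteType k (IntegralInfty k x) := by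
  have := hb.finite
  exact Algebra.FiniteType.trans (R := k) (S := CoordInfty k x) (A := IntegralInfty k x)
    inferInstance inferInstance

namespace PointInfty

variable (P : PointInfty k x)

theorem finite_residueField [Module.Finite (CoordInfty k x) (IntegralInfty k x)] :
    Module.Finite k P.ResidueField :=
  Module.Finite.quotient_of_mem (A := CoordInfty k x) (t := invCoord k x)
    CoordInfty.exists_eq_add P.ideal P.inv_mem

theorem isIntegral_residueField [Module.Finite (CoordInfty k x) (IntegralInfty k x)] :
    Algebra.IsIntegral k P.ResidueField :=
  Algebra.IsIntegral.quotient_of_mem (A := CoordInfty k x) (t := invCoord k x)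
    CoordInfty.exists_eq_add P.ideal P.inv_mem

theorem ramificationIndex_pos [Module.Finite (CoordInfty k x) (IntegralInfty k x)] :
    0 < P.ramificationIndex := by
  have := P.isMaximal.isPrime
  exact Ideal.ramificationIdx_pos P.ideal (R := CoordInfty k x)

variable [IsDedekindDomain (IntegralInfty k x)] [IsFractionRing (IntegralInfty k x) K]

/-- The valuation of the function field at a point over `x = ∞`. -/
abbrev val (ht : invCoord k x ≠ 0) : Valuation K ℤᵐ⁰ := (P.place ht).valuation K

/-- Reduction of the functions regular at a point over `x = ∞`. -/
def residueMap (ht : invCoord k x ≠ 0) : ResidueMap k (P.val ht) P.ResidueField :=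
  (P.place ht).residueMap k K

theorem hasResidue_iff (ht : invCoord k x ≠ 0) (ω : Ω[K⁄k]) (a : P.ResidueField) :
    P.HasResidue ω a ↔ (P.residueMap ht).HasResidueAt ω a := by
  refine Iff.trans ?_ ((P.place ht).hasResidueAt_iff_exists ω a).symm
  constructor
  · rintro ⟨z, f, φ, hφ, h⟩
    exact ⟨z, f, φ.toRingHom, φ.commutes, hφ.map_coord, hφ.map_regular, h⟩
  · rintro ⟨z, f, φ, hc, hz, hφ, h⟩
    exact ⟨z, f, ⟨φ, hc⟩, ⟨hz, hφ⟩, h⟩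

theorem val_inv_coord (ht : invCoord k x ≠ 0) (h : (Ideal.span {invCoord k x}).IsMaximal) :
    P.val ht x⁻¹ = exp (-(P.ramificationIndex : ℤ)) := by
  have : (P.place ht).asIdeal.LiesOver (Ideal.span {invCoord k x}) := P.liesOver h
  exact (P.place ht).valuation_eq_exp_ramificationIdx (A := CoordInfty k x) K ht

theorem val_le_one (ht : invCoord k x ≠ 0) {f : K} (hf : f ∈ IntegralInfty k x) :
    P.val ht f ≤ 1 :=
  (P.place ht).valuation_le_one ⟨f, hf⟩

theorem exists_val_eq (ht : invCoord k x ≠ 0) : ∃ π, P.val ht π = exp (-1) :=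
  (P.place ht).valuation_exists_uniformizer K

end PointInfty

variable [IsDedekindDomain (IntegralInfty k x)] [IsFractionRing (IntegralInfty k x) K]
  [Module.Finite (CoordInfty k x) (IntegralInfty k x)]
  (h : (Ideal.span {invCoord k x}).IsMaximal)

include h in
omit [IsFractionRing (IntegralInfty k x) K]
  [Module.Finite (CoordInfty k x) (IntegralInfty k x)] in
theorem finite_pointInfty : Finite (PointInfty k x) :=
  Finite.of_equiv _ (PointInfty.equivPrimesOver h).symm

include h in
omit [IsFractionRing (IntegralInfty k x) K] [IsDedekindDomain (IntegralInfty k x)] in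
/-- The fundamental identity `∑ e f = n`. -/
theorem sum_ramificationIndex_mul_residueDegree [IsDedekindDomain (CoordInfty k x)]
    [Fintype (PointInfty k x)] {d : ℕ} {b : Fin d → K} (hb : IsIntegralBasisInfty k x b) :
    ∑ P : PointInfty k x, P.ramificationIndex * Module.finrank k P.ResidueField = d := by
  have := h.isPrime
  have := Fintype.ofEquiv _ (PointInfty.equivPrimesOver h)
  have h1 := Ideal.sum_ramification_inertia_eq_finrank (R := CoordInfty k x)
    (S := IntegralInfty k x) (Ideal.span {invCoord k x})
  rw [Module.finrank_eq_card_basis hb.basis, Fintype.card_fin,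
    ← (PointInfty.equivPrimesOver h).sum_comp] at h1
  rw [← h1]
  refine Finset.sum_congr rfl fun P _ => ?_
  have := P.liesOver h
  congr 1
  exact (Ideal.inertiaDeg_eq_finrank (A := CoordInfty k x) (t := invCoord k x)
    CoordInfty.exists_eq_add P.ideal).symm

end PlacesInfty

/-! ### Residues and exponents over `x = ∞` -/

section ResiduesInfty

open WithZero IsDedekindDomain

theorem isUnit_natCast_of_algebra (k κ : Type*) [Field k] [CharZero k] [CommRing κ] [Algebra k κ]
    {n : ℕ} (hn : n ≠ 0) : IsUnit (n : κ) := by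
  simpa using (IsUnit.mk0 _ (Nat.cast_ne_zero.2 hn : (n : k) ≠ 0)).map (algebraMap k κ)

/-- The derivation `d/dx` in terms of the coordinate `1/x`. -/
theorem exists_derivation_coord {k K : Type*} [Field k] [CharZero k] [Field K] [Algebra k K]
    [Algebra (RatFunc k) K] [IsScalarTower k (RatFunc k) K] [FiniteDimensional (RatFunc k) K]
    {x : K} (hx : x = algebraMap (RatFunc k) K RatFunc.X) :
    ∃ δ : Derivation k K K, δ x = 1 ∧ (∀ f, D k K f = δ f • D k K x) ∧ δ ≠ 0 ∧ δ x⁻¹ ≠ 0 ∧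
      δ x⁻¹ / x⁻¹ = -x⁻¹ ∧ ∀ f, logDerivation δ x⁻¹ f = -(x * δ f) := by
  obtain ⟨δ, hδx, hδ⟩ := exists_derivation_of_functionField k K
  rw [← hx] at hδx
  simp only [← hx] at hδ
  have hx0 := coord_ne_zero hx
  have h : δ x⁻¹ = -(x⁻¹ * x⁻¹) := by
    rw [δ.leibniz_inv, hδx, smul_eq_mul, mul_one, pow_two]
  refine ⟨δ, hδx, hδ, ?_, by rw [h]; simpa using hx0, by rw [h]; field_simp, fun f => ?_⟩
  · rintro rfl
    exact zero_ne_one hδx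
  · rw [logDerivation, Derivation.smul_apply, h, smul_eq_mul]
    field_simp

variable {k K : Type*} [Field k] [CharZero k] [Field K] [Algebra k K] [Algebra (RatFunc k) K]
  [IsScalarTower k (RatFunc k) K] {x : K} {d : ℕ} {b : Fin d → K}
  [IsDedekindDomain (IntegralInfty k x)] [IsFractionRing (IntegralInfty k x) K]

omit [CharZero k] in
/-- A `k`-linear combination of an integral basis is not divisible by `1/x`. -/
theorem IsIntegralBasisInfty.eq_zero_of_val_le (hb : IsIntegralBasisInfty k x b)
    (hx : x = algebraMap (RatFunc k) K RatFunc.X) (c : Fin d → k)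
    (hc : ∀ P : PointInfty k x, P.val (invCoord_ne_zero hx) (∑ i, c i • b i) ≤
      exp (-(P.ramificationIndex : ℤ))) : c = 0 := by
  refine hb.basis.eq_zero_of_valuation_sum_smul_le (K := K) (invCoord_ne_zero hx)
    (invCoord_not_isUnit hx) c fun w hw => ?_
  let P : PointInfty k x := ⟨w.asIdeal, w.isMaximal, hw⟩
  have h1 := hc P
  rw [← P.val_inv_coord (invCoord_ne_zero hx) (span_invCoord_isMaximal hx)] at h1
  have h2 : ∑ i, c i • algebraMap (IntegralInfty k x) K (hb.basis i) = ∑ i, c i • b i :=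
    Finset.sum_congr rfl fun i _ => congrArg (c i • ·) (hb.basis_apply i)
  rw [h2]
  exact h1

variable [FiniteDimensional (RatFunc k) K]

/-- An exponent filtration of the residue matrix by orders of vanishing over `x = ∞`. -/
theorem IsIntegralBasisInfty.exists_exponentFiltration (hb : IsIntegralBasisInfty k x b)
    (hx : x = algebraMap (RatFunc k) K RatFunc.X) {G : Matrix (Fin d) (Fin d) (RatFunc k)}
    (hG : ∀ j, D k K (b j) = (∑ i, G i j • b i) • D k K x) :
    ∃ E : ExponentFiltration (residueEndInfty G)
        (fun P : PointInfty k x => P.ramificationIndex) (fun P => P.ResidueField),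
      ∀ P i c, c ∈ E.F P i ↔
        P.val (invCoord_ne_zero hx) (∑ j, c j • b j) ≤ exp (-(i : ℤ)) := by
  have := hb.finite
  have := hb.finiteType
  obtain ⟨δ, hδx, hδ, hδ0, h1, -, h3⟩ := exists_derivation_coord hx
  have hH : ∀ j, logDerivation δ x⁻¹ (b j) =
      ∑ i, (-((RatFunc.X : RatFunc k) • G)) i j • b i := by
    intro j
    have : δ (b j) = ∑ i, G i j • b i := by
      simpa [hδx] using congrArg δ.liftKaehlerDifferential (hG j)
    rw [h3, this, Finset.mul_sum, ← Finset.sum_neg_distrib]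
    refine Finset.sum_congr rfl fun i _ => ?_
    rw [Matrix.neg_apply, Matrix.smul_apply, smul_eq_mul, neg_smul, mul_smul, hx,
      Algebra.smul_def RatFunc.X]
  have hres : residueMatrixInfty G = (-((RatFunc.X : RatFunc k) • G)).map valueAtInfty := by
    ext i j
    rw [residueMatrixInfty_apply]
    rfl
  rw [residueEndInfty, hres]
  refine _root_.exists_exponentFiltration (fun P => P.residueMap (invCoord_ne_zero hx)) hx
    (fun P => P.ramificationIndex_pos)
    (fun P => P.val_inv_coord (invCoord_ne_zero hx) (span_invCoord_isMaximal hx))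
    (fun P i => P.val_le_one (invCoord_ne_zero hx) (hb.mem i))
    (fun c hc => hb.eq_zero_of_val_le hx c hc)
    (fun P => P.exists_val_eq (invCoord_ne_zero hx)) (logDerivation δ x⁻¹)
    (fun P i f hf => ?_) hH
  have := P.isIntegral_residueField
  obtain ⟨π, hπ⟩ := P.exists_val_eq (invCoord_ne_zero hx)
  exact (P.residueMap (invCoord_ne_zero hx)).val_logDerivation_sub_le' δ hδ0
    ((P.place (invCoord_ne_zero hx)).exists_val_derivation_le K δ) hπ h1 P.ramificationIndex_pos
    (P.val_inv_coord (invCoord_ne_zero hx) (span_invCoord_isMaximal hx)) i f hf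

/-- A `1`-form has a unique residue at a point over `x = ∞`. -/
theorem PointInfty.existsUnique_hasResidue (hb : IsIntegralBasisInfty k x b)
    (hx : x = algebraMap (RatFunc k) K RatFunc.X) (P : PointInfty k x) (f : K) :
    ∃! a, P.HasResidue (f • D k K x) a := by
  have := hb.finite
  have := hb.finiteType
  have := P.isIntegral_residueField
  obtain ⟨δ, hδx, hδ, hδ0, h1, h2, -⟩ := exists_derivation_coord hx
  obtain ⟨g, rfl⟩ : ∃ g, f = g * (δ x⁻¹ / x⁻¹) := ⟨-(f * x), by
    rw [h2, neg_mul_neg, mul_inv_cancel_right₀ (coord_ne_zero hx)]⟩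
  obtain ⟨π, hπ⟩ := P.exists_val_eq (invCoord_ne_zero hx)
  have hM := (P.place (invCoord_ne_zero hx)).exists_val_derivation_le K δ
  have ht := P.val_inv_coord (invCoord_ne_zero hx) (span_invCoord_isMaximal hx)
  obtain ⟨a, h, ha, hah⟩ := (P.residueMap (invCoord_ne_zero hx)).exists_eq_add_logDerivation δ hδ0
    hM hπ h1 P.ramificationIndex_pos ht g
  have key := fun c => (P.hasResidue_iff (invCoord_ne_zero hx) _ c).trans
    ((P.residueMap (invCoord_ne_zero hx)).hasResidueAt_iff hδx hδ hM hπ h1 ht ha hah c)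
  exact ⟨_, (key _).2 rfl, fun c hc => (key c).1 hc⟩

/-- The residue of `g dx / x` with `g` regular at `P` is zero exactly if `g` vanishes at `P`. -/
theorem PointInfty.hasResidue_zero_iff (hb : IsIntegralBasisInfty k x b)
    (hx : x = algebraMap (RatFunc k) K RatFunc.X) (P : PointInfty k x) {g : K}
    (hg : P.val (invCoord_ne_zero hx) g ≤ 1) :
    P.HasResidue ((g * x⁻¹) • D k K x) 0 ↔ P.val (invCoord_ne_zero hx) g < 1 := by
  have := hb.finite
  have := hb.finiteType
  have := P.isIntegral_residueField
  obtain ⟨δ, hδx, hδ, -, h1, h2, -⟩ := exists_derivation_coord hx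
  obtain ⟨π, hπ⟩ := P.exists_val_eq (invCoord_ne_zero hx)
  have hM := (P.place (invCoord_ne_zero hx)).exists_val_derivation_le K δ
  have ht := P.val_inv_coord (invCoord_ne_zero hx) (span_invCoord_isMaximal hx)
  have hg' : P.val (invCoord_ne_zero hx) (-g) ≤ 1 := by rwa [Valuation.map_neg]
  have key := (P.residueMap (invCoord_ne_zero hx)).hasResidueAt_iff hδx hδ hM hπ h1 ht
    (g := -g) (h := 0) hg' (by simp) 0
  rw [h2, neg_mul_neg] at key
  have hzero := (P.residueMap (invCoord_ne_zero hx)).eq_zero_iff _ hg'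
  rw [Valuation.map_neg] at hzero
  rw [P.hasResidue_iff (invCoord_ne_zero hx), key, ← hzero, eq_comm]
  exact (isUnit_natCast_of_algebra k P.ResidueField P.ramificationIndex_pos.ne').mul_right_eq_zero

/-- In `(∑ u_i b_i) dx / r`, the coefficient with respect to `dx / x` is `x ^ n / r` times a regular
function whose value modulo `1/x` is the vector of the values of `x ^ (1 - n) u`. -/
theorem PointInfty.hasResidue_zero_iff_val_sum_smul (hb : IsIntegralBasisInfty k x b)
    (hx : x = algebraMap (RatFunc k) K RatFunc.X) (P : PointInfty k x) {r : RatFunc k} (hr : r ≠ 0)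
    (U : Fin d → RatFunc k) (hU : ∀ i, (RatFunc.X ^ (1 - r.intDegree) * U i).intDegree ≤ 0) :
    P.HasResidue (((∑ i, U i • b i) / algebraMap (RatFunc k) K r) • D k K x) 0 ↔
      P.val (invCoord_ne_zero hx)
        (∑ i, valueAtInfty (RatFunc.X ^ (1 - r.intDegree) * U i) • b i) < 1 := by
  have := hb.finite
  have hx0 := coord_ne_zero hx
  have hr0 : algebraMap (RatFunc k) K r ≠ 0 := by
    rwa [Ne, FaithfulSMul.algebraMap_eq_zero_iff]
  have ht := P.val_inv_coord (invCoord_ne_zero hx) (span_invCoord_isMaximal hx)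
  have he := P.ramificationIndex_pos
  have hk : ∀ c : k, c ≠ 0 → P.val (invCoord_ne_zero hx) (algebraMap k K c) = 1 := fun c hc =>
    (P.residueMap (invCoord_ne_zero hx)).val_algebraMap_of_ne_zero hc
  set n := r.intDegree
  set h := ∑ i, (RatFunc.X ^ (1 - n) * U i) • b i with hh
  have h1 : (∑ i, U i • b i) / algebraMap (RatFunc k) K r =
      (algebraMap (RatFunc k) K (RatFunc.X ^ n / r) * h) * x⁻¹ := by
    have : h = x ^ (1 - n) * ∑ i, U i • b i := by
      rw [hh, Finset.mul_sum]
      refine Finset.sum_congr rfl fun i _ => ?_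
      rw [mul_smul, Algebra.smul_def, map_zpow₀, ← hx]
    rw [this, map_div₀, map_zpow₀, ← hx, zpow_sub₀ hx0, zpow_one]
    field_simp
  have h2 : P.val (invCoord_ne_zero hx) (algebraMap (RatFunc k) K (RatFunc.X ^ n / r)) = 1 := by
    have hX : (RatFunc.X ^ n : RatFunc k) ≠ 0 := zpow_ne_zero _ RatFunc.X_ne_zero
    rw [val_algebraMap_ratFunc hx hk he ht _ (div_ne_zero hX hr), RatFunc.intDegree_div hX hr,
      RatFunc.intDegree_X_zpow, sub_self, mul_zero, exp_zero]
  have h3 : P.val (invCoord_ne_zero hx) h ≤ 1 := (P.val _).map_sum_le fun i _ => by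
    rw [Algebra.smul_def, map_mul]
    exact mul_le_one' (val_le_one_of_intDegree_le hx hk he ht (hU i))
      (P.val_le_one (invCoord_ne_zero hx) (hb.mem i))
  have h4 : P.val (invCoord_ne_zero hx)
      (h - ∑ i, valueAtInfty (RatFunc.X ^ (1 - n) * U i) • b i) < 1 :=
    (val_sum_smul_sub_le (fun P : PointInfty k x => P.residueMap (invCoord_ne_zero hx)) hx
      (fun P => P.ramificationIndex_pos)
      (fun P => P.val_inv_coord (invCoord_ne_zero hx) (span_invCoord_isMaximal hx))
      (fun P i => P.val_le_one (invCoord_ne_zero hx) (hb.mem i)) hU P).trans_lt (by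
        rw [← exp_zero, exp_lt_exp]; omega)
  rw [h1, P.hasResidue_zero_iff hb hx (by rw [map_mul, h2, one_mul]; exact h3), map_mul, h2,
    one_mul]
  constructor
  · intro h5
    simpa using (P.val _).map_sub_lt h5 h4
  · intro h5
    simpa using (P.val _).map_add_lt h4 h5

/-- The exponents of the connection at `x = ∞` and the residues of forms with at most a logarithmic
pole there. -/
theorem IsIntegralBasisInfty.residues (hb : IsIntegralBasisInfty k x b)
    (hx : x = algebraMap (RatFunc k) K RatFunc.X) {G : Matrix (Fin d) (Fin d) (RatFunc k)}
    (hG : ∀ j, D k K (b j) = (∑ i, G i j • b i) • D k K x) {r : RatFunc k} (hr : r ≠ 0)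
    (U : Fin d → RatFunc k) (hU : ∀ i, (RatFunc.X ^ (1 - r.intDegree) * U i).intDegree ≤ 0)
    (v : Fin d → k) (hv : ∀ i, v i = valueAtInfty (RatFunc.X ^ (1 - r.intDegree) * U i)) :
    IsDiagonalisable (residueEndInfty G) ∧
    (residueMatrixInfty G).charpoly =
        ∏ᶠ P : PointInfty k x, ∏ j ∈ Finset.range P.ramificationIndex,
          (X - C ((j : k) / (P.ramificationIndex : k))) ^ P.residueDegree ∧
    (∀ P : PointInfty k x,
        ∃! a, P.HasResidue (((∑ i, U i • b i) / algebraMap (RatFunc k) K r) • D k K x) a) ∧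
    ∃ h : HasGenEigenDecomposition (residueEndInfty G),
      ((∀ P : PointInfty k x,
          P.HasResidue (((∑ i, U i • b i) / algebraMap (RatFunc k) K r) • D k K x) 0) ↔
        genEigenProj (residueEndInfty G) h 0 v = 0) := by
  have hmax := span_invCoord_isMaximal hx
  have := hb.finite
  have : IsDedekindDomain (CoordInfty k x) := inferInstance
  have := finite_pointInfty hmax
  have := Fintype.ofFinite (PointInfty k x)
  have := fun P : PointInfty k x => P.finite_residueField
  obtain ⟨H, hH⟩ := hb.exists_exponentFiltration hx hG
  refine ⟨H.isDiagonalisable, ?_, fun P => P.existsUnique_hasResidue hb hx _,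
    H.hasGenEigenDecomposition, ?_⟩
  · rw [finprod_eq_prod_of_fintype, ← Matrix.charpoly_toLin']
    refine H.charpoly_eq ?_
    rw [sum_ramificationIndex_mul_residueDegree hmax hb, Module.finrank_fin_fun]
  · rw [H.genEigenProj_zero_eq_zero_iff fun P => P.ramificationIndex_pos]
    refine forall_congr' fun P => ?_
    rw [hH, P.hasResidue_zero_iff_val_sum_smul hb hx hr U hU, ← exp_zero,
      WithZero.lt_exp_iff_le_exp_sub_one]
    simp only [← hv]
    rfl

end ResiduesInfty

/-! ### The lifted curve -/

/-- The characteristic of the domain `W(F)` is zero: a prime that is zero in it is zero in `F`, hence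
equal to `p`, but `p` is not zero in `W(F)`. -/
theorem WittVector.charZero (p : ℕ) [Fact p.Prime] (F : Type*) [Field F] [CharP F p] :
    CharZero (WittVector p F) := by
  obtain ⟨ℓ, hℓ⟩ := CharP.exists (WittVector p F)
  rcases CharP.char_is_prime_or_zero (WittVector p F) ℓ with h | rfl
  · have h1 : (ℓ : F) = 0 := by
      rw [← map_natCast (WittVector.constantCoeff (p := p) (R := F)), CharP.cast_eq_zero, map_zero]
    rw [CharP.cast_eq_zero_iff F p, Nat.prime_dvd_prime_iff_eq Fact.out h] at h1
    subst h1
    exact absurd (CharP.cast_eq_zero (WittVector p F) p) (WittVector.p_nonzero p F)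
  · exact CharP.charP_to_charZero _

instance (p : ℕ) [Fact p.Prime] (F : Type*) [Field F] [CharP F p] : CharZero (QqField p F) :=
  have := WittVector.charZero p F
  charZero_of_injective_algebraMap (IsFractionRing.injective (WittVector p F) (QqField p F))

namespace PlaneCurveLift

variable {p : ℕ} [Fact p.Prime] {F : Type*} [Field F] [CharP F p]

theorem toRatFunc_injective : Function.Injective (toRatFunc p F) :=
  (IsFractionRing.injective (QqField p F)[X] (RatFunc (QqField p F))).comp
    (Polynomial.map_injective _ (IsFractionRing.injective (WittVector p F) (QqField p F)))

theorem intDegree_toRatFunc (r : (WittVector p F)[X]) :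
    (toRatFunc p F r).intDegree = r.natDegree := by
  rw [toRatFunc, RingHom.comp_apply, RatFunc.intDegree_polynomial, coe_mapRingHom,
    natDegree_map_eq_of_injective (IsFractionRing.injective _ _)]

variable [Finite F] (E : PlaneCurveLift p F)

theorem separable_genericPoly : E.genericPoly.Separable :=
  (irreducible_genericPoly E).out.separable

instance : FiniteDimensional (RatFunc (QqField p F)) E.FunctionField :=
  (AdjoinRoot.powerBasis (irreducible_genericPoly E).out.ne_zero).finite

theorem discr_lift_ne_zero : E.lift.discr ≠ 0 := by
  have hnat : E.genericPoly.natDegree = E.lift.natDegree :=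
    natDegree_map_eq_of_injective toRatFunc_injective _
  have hpos : 0 < E.lift.natDegree := by
    rw [← hnat]
    exact (irreducible_genericPoly E).out.natDegree_pos
  intro h0
  have h1 := resultant_deriv (natDegree_pos_iff_degree_pos.1 hpos)
  rw [h0, mul_zero] at h1
  have h2 := congrArg (toRatFunc p F) h1
  rw [map_zero, ← resultant_map_map, ← derivative_map] at h2
  refine resultant_ne_zero _ _ E.separable_genericPoly ?_
  rw [Polynomial.natDegree_derivative, hnat]
  exact h2

theorem IsSquarefreeDiscr.ne_zero {E : PlaneCurveLift p F} {r : (WittVector p F)[X]}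
    (hr : E.IsSquarefreeDiscr r) : r ≠ 0 := by
  rintro rfl
  obtain ⟨g, -, h⟩ := hr
  exact E.discr_lift_ne_zero (by rw [h, zero_mul])

end PlaneCurveLift

end

theorem mainTheorem10 (p : ℕ) [Fact p.Prime] (F : Type*) [Field F] [Finite F] [CharP F p]
    (E : PlaneCurveLift p F)
    (r : (WittVector p F)[X]) (hr : E.IsSquarefreeDiscr r)
    (W : Matrix.GeneralLinearGroup (Fin E.degX) (WittVector p F)[T;T⁻¹])
    (hW : IsIntegralBasisInfty (QqField p F) E.x (E.basisInfty W))
    (G : Matrix (Fin E.degX) (Fin E.degX) (RatFunc (QqField p F)))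
    (hG : E.IsConnectionMatrix (E.basisInfty W) G)
    (u : Fin E.degX → (QqField p F)[T;T⁻¹])
    (U : Fin E.degX → RatFunc (QqField p F))
    (hU : ∀ i, U i = laurentToRatFunc (QqField p F) (QqField p F) (u i))
    (hu : ordInftyVec U > ((-(r.natDegree : ℤ) : ℤ) : WithTop ℤ))
    (v : Fin E.degX → QqField p F)
    (hv : ∀ i, v i = valueAtInfty (RatFunc.X ^ (1 - (r.natDegree : ℤ)) * U i)) :
    -- the residue matrix is diagonalisable
    IsDiagonalisable (residueEndInfty G) ∧
    -- its eigenvalues are the `j / e_P` with `0 ≤ j < e_P`, with multiplicity `deg P`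
    (residueMatrixInfty G).charpoly =
        ∏ᶠ P : PointInfty (QqField p F) E.x, ∏ j ∈ Finset.range P.ramificationIndex,
          (X - C ((j : QqField p F) / (P.ramificationIndex : QqField p F))) ^ P.residueDegree ∧
    -- the `1`-form has a well defined residue at every point over `x = ∞`
    (∀ P : PointInfty (QqField p F) E.x,
        ∃! a, P.HasResidue (E.formInfty (E.basisInfty W) r U) a) ∧
    -- all of them vanish iff the projection onto the `0`-generalised eigenspace vanishes
    ∃ h : HasGenEigenDecomposition (residueEndInfty G),
      ((∀ P : PointInfty (QqField p F) E.x,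
          P.HasResidue (E.formInfty (E.basisInfty W) r U) 0) ↔
        genEigenProj (residueEndInfty G) h 0 v = 0) := by
  have hx : E.x = algebraMap (RatFunc (QqField p F)) E.FunctionField RatFunc.X := rfl
  have := isDedekindDomain_integralInfty hx
  have := isFractionRing_integralInfty hx
  have hr0 : PlaneCurveLift.toRatFunc p F r ≠ 0 := by
    rw [Ne, map_eq_zero_iff _ PlaneCurveLift.toRatFunc_injective]
    exact hr.ne_zero
  refine hW.residues hx hG hr0 U (fun i => ?_) v ?_
  · rw [PlaneCurveLift.intDegree_toRatFunc]
    by_cases h0 : U i = 0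
    · simp [h0]
    · have h1 : ordInfty (U i) > ((-(r.natDegree : ℤ) : ℤ) : WithTop ℤ) :=
        lt_of_lt_of_le hu (Finset.inf_le (Finset.mem_univ i))
      rw [ordInfty_eq _ h0, gt_iff_lt, WithTop.coe_lt_coe] at h1
      rw [RatFunc.intDegree_mul (zpow_ne_zero _ RatFunc.X_ne_zero) h0, RatFunc.intDegree_X_zpow]
      omega
  · rw [PlaneCurveLift.intDegree_toRatFunc]
    exact hv
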